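/- **Definitions.** A *strong projection algebra* is a non-empty set $P$ with two binary operations $\times,\star$ such that for all $e,f,g\in P$: $e\times e=e$; $(e\times f)\times e=e\times f$; $e\times(f\times g)=(e\times f)\times(f\times g)$; $(e\times f)\times g=(e\times f)\times(e\times g)$; $e\star e=e$; $f\star e=e\star(f\star e)$; $(g\star f)\star e=(g\star f)\star(f\star e)$; $g\star(f\star e)=(g\star e)\star(f\star e)$; $(e\star(f\times g))\star g=(e\star f)\star g$; $g\times((g\star f)\times e)=g\times(f\times e)$; $(e\times f)\star e=e\times f$; $f\times(e\star f)=e\star f$; $e\times(((e\times f)\times g)\star f)=(e\times f)\times g$; $(f\times(g\star(f\star e)))\star e=g\star(f\star e)$. Together with the maps preserving $\times$ and $\star$, these form the category $\mathbb{SPA}$. Write $e\le f$ if $e=f\times e$, and $p\,\mathcal F\,q$ if $p\times q=p$ and $p\star q=q$. A *DRC-restriction semigroup* is a non-empty semigroup $S$ with two unary operations ${}^+,{}^*$ such that for all $x,y\in S$: $x^+x=x$, $(xy)^+=(xy^+)^+$, $(xy)^+=x^+(xy)^+x^+$, $x^{++}=x^+$, $x^{+*}=x^+$; $xx^*=x$,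 $(xy)^*=(x^*y)^*$, $(xy)^*=y^*(xy)^*y^*$, $x^{**}=x^*$, $x^{*+}=x^*$; $x(yx)^*=(yx^+)^*x$ and $(xy)^+x=x(x^*y)^+$. Together with the maps preserving the three operations ($(2,1,1)$-homomorphisms), these form the category $\mathbb{DRS}$. The set of projections $P(S)=\{x^+\mid x\in S\}$ is a strong projection algebra under $e\times f=(ef)^+$, $e\star f=(ef)^*$. The forgetful functor $\mathcal U:\mathbb{DRS}\to\mathbb{SPA}$ sends $S$ to $P(S)$ and $\phi:S\to T$ to its restriction $P(S)\to P(T)$. Let $P$ be a strong projection algebra. A *path* is a sequence $\mathfrak p=(p_1,\dots,p_k)$ in $P$, $k\ge 1$, with $p_i\,\mathcal F\,p_{i+1}$ for $1\le i<k$. Paths form a small category under $(p_1,\dots,p_k)\circ(p_k,q_2,\dots,q_l)=(p_1,\dots,p_k,q_2,\dots,q_l)$. Let $\approx$ be the least congruence on this category such that $(p,p)\approx(p)$ for all $p\in P$ and $(e,e\star p,f)\approx(e,p\times f,f)$ for all $e,p,f\in P$ with $f=(e\star p)\star f$ and $e=e\times(p\times f)$. Write $[p_1,\dots,p_k]$ for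 the class of $(p_1,\dots,p_k)$, and $\mathscr C(P)$ for the set of all classes. For $q\le p_1$ let ${}_q{\downharpoonleft}\mathfrak p=(q_1,\dots,q_k)$ with $q_1=q$, $q_i=q_{i-1}\star p_i$; for $q\le p_k$ let $\mathfrak p{\downharpoonright}_q=(q_1,\dots,q_k)$ with $q_k=q$, $q_i=p_i\times q_{i+1}$. The *chain semigroup* $\mathbf S(\mathscr C(P))$ is the set $\mathscr C(P)$ with, for $\mathfrak p=(p_1,\dots,p_k)$ and $\mathfrak q=(q_1,\dots,q_l)$, $$[\mathfrak p]\bullet[\mathfrak q]=\big[\mathfrak p{\downharpoonright}_{p_k\times q_1}\circ(p_k\times q_1,\;p_k\star q_1)\circ{}_{p_k\star q_1}{\downharpoonleft}\mathfrak q\big],\qquad [\mathfrak p]^+=[p_1],\qquad [\mathfrak p]^*=[p_k];$$ it is a DRC-restriction semigroup. The functor $\mathcal V:\mathbb{SPA}\to\mathbb{DRS}$ sends $P$ to $\mathbf S(\mathscr C(P))$ and $\psi:P\to Q$ to $[p_1,\dots,p_k]\mapsto[p_1\psi,\dots,p_k\psi]$. **Theorem.** The functor $\mathcal V$ is left adjoint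 to $\mathcal U$, and the unit $\eta:\mathrm{id}_{\mathbb{SPA}}\to\mathcal U\mathcal V$ of the adjunction is given by $$\eta_P:P\to\mathcal U\mathcal V(P)=\{[p]\mid p\in P\},\qquad p\mapsto[p].$$ That is, $\eta$ is a natural transformation, and for every strong projection algebra $P$, every DRC-restriction semigroup $S$ and every homomorphism $\phi:P\to P(S)$ there is a unique $(2,1,1)$-homomorphism $\Phi:\mathbf S(\mathscr C(P))\to S$ with $[p]\Phi=p\phi$ for all $p\in P$. Hence the free DRC-restriction semigroups over strong projection algebras are, up to isomorphism, exactly the chain semigroups. In detail: call $S$ *free over* $P$ *with respect to* a homomorphism $\phi:P\to P(S)$ if for every DRC-restriction semigroup $T$ and every homomorphism $\psi:P\to P(T)$ there is a unique $(2,1,1)$-homomorphism $\Psi:S\to T$ with $p\phi\Psi=p\psi$ for all $p\in P$. Then $S$ is free over $P$ with respect to $\phi$ if and only if there is a unique isomorphism $\theta:\mathbf S(\mathscr C(P))\to S$ with $[p]\theta=p\phi$ for all $p\in P$; and $S$ is free over some strong projection algebra if and only if it is isomorphic to a chain semigroup. -/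

import Mathlib

universe u

open CategoryTheory

namespace ChainSG

/-! Two-sided projection algebras -/

/-- The two binary operations of a projection algebra: `e ⊠ f` and `e ⊛ f`. -/
class ProjOps (P : Type u) where
  times : P → P → P
  ast : P → P → P

infixl:70 " ⊠ " => ProjOps.times
infixl:70 " ⊛ " => ProjOps.ast

/-- Two-sided projection algebras: `⊠` is a left projection algebra operation, `⊛` is a right
projection algebra operation, and they are linked by `p3`, `p3'`, `p4`, `p4'`. -/
class ProjectionAlgebra (P : Type u) extends ProjOps P where
  l1 : ∀ e : P, e ⊠ e = e
  l2 : ∀ e f : P, (e ⊠ f) ⊠ e = e ⊠ f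
  l3 : ∀ e f g : P, e ⊠ (f ⊠ g) = (e ⊠ f) ⊠ (f ⊠ g)
  l4 : ∀ e f g : P, (e ⊠ f) ⊠ g = (e ⊠ f) ⊠ (e ⊠ g)
  r1 : ∀ e : P, e ⊛ e = e
  r2 : ∀ e f : P, f ⊛ e = e ⊛ (f ⊛ e)
  r3 : ∀ e f g : P, (g ⊛ f) ⊛ e = (g ⊛ f) ⊛ (f ⊛ e)
  r4 : ∀ e f g : P, g ⊛ (f ⊛ e) = (g ⊛ e) ⊛ (f ⊛ e)
  p3 : ∀ e f g : P, (e ⊛ (f ⊠ g)) ⊛ g = (e ⊛ f) ⊛ g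
  p3' : ∀ e f g : P, g ⊠ ((g ⊛ f) ⊠ e) = g ⊠ (f ⊠ e)
  p4 : ∀ e f : P, (e ⊠ f) ⊛ e = e ⊠ f
  p4' : ∀ e f : P, f ⊠ (e ⊛ f) = e ⊛ f

/-- Strong projection algebras. -/
class StrongProjectionAlgebra (P : Type u) extends ProjectionAlgebra P where
  sp1 : ∀ e f g : P, e ⊠ (((e ⊠ f) ⊠ g) ⊛ f) = (e ⊠ f) ⊠ g
  sp2 : ∀ e f g : P, (f ⊠ (g ⊛ (f ⊛ e))) ⊛ e = g ⊛ (f ⊛ e)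

/-- The natural partial order `e ≤ f` of a projection algebra. -/
def PLe {P : Type u} [ProjOps P] (e f : P) : Prop := e = f ⊠ e

/-- The relation `p F q` of a projection algebra. -/
def FRel {P : Type u} [ProjOps P] (p q : P) : Prop := p ⊠ q = p ∧ p ⊛ q = q

section ProjectionAlgebraLemmas

variable {P : Type u}

section Basic
variable [ProjectionAlgebra P]
open ProjectionAlgebra

theorem times_idem (e f : P) : e ⊠ (e ⊠ f) = e ⊠ f := by
  have := l4 e e f
  rw [l1] at this
  exact this.symm

theorem ast_idem (e f : P) : (f ⊛ e) ⊛ e = f ⊛ e := by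
  have := r4 e e f
  rw [r1] at this
  exact this.symm

theorem ast_idem' (e f : P) : e ⊛ (e ⊛ f) = e ⊛ f := by
  rw [r4, r1]

theorem times_idem' (e f : P) : (e ⊠ f) ⊠ f = e ⊠ f := by
  rw [l4, l1]

theorem times_ple (e f : P) : PLe (e ⊠ f) e := (times_idem e f).symm

theorem ast_ple (e f : P) : PLe (e ⊛ f) f := (p4' e f).symm

theorem PLe.times_left {e f : P} (h : PLe e f) : f ⊠ e = e := h.symm

theorem PLe.times_right {e f : P} (h : PLe e f) : e ⊠ f = e := by
  have h1 := l2 f e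
  rwa [h.times_left] at h1

theorem PLe.ast_right {e f : P} (h : PLe e f) : e ⊛ f = e := by
  have h1 := p4 f e
  rwa [h.times_left] at h1

theorem PLe.ast_left {e f : P} (h : PLe e f) : f ⊛ e = e := by
  have h1 := r2 f e
  rw [h.ast_right] at h1
  exact h1.symm

theorem times_ast (e f : P) : (e ⊠ f) ⊛ f = e ⊛ f := by
  have h := p3 e e f
  rwa [(times_ple e f).ast_left, r1] at h

theorem ast_times (e f : P) : e ⊠ (e ⊛ f) = e ⊠ f := by
  have h := p3' f f e
  rwa [(ast_ple e f).times_right, l1] at h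

theorem times_times_ast (e f : P) : (e ⊠ f) ⊠ (e ⊛ f) = e ⊠ f := by
  rw [← times_ast e f, ast_times, times_idem']

theorem times_ast_ast (e f : P) : (e ⊠ f) ⊛ (e ⊛ f) = e ⊛ f := by
  rw [← ast_times e f, times_ast, ast_idem']

theorem fRel_times_ast (p q : P) : FRel (p ⊠ q) (p ⊛ q) :=
  ⟨times_times_ast p q, times_ast_ast p q⟩

theorem fRel_self (p : P) : FRel p p := ⟨l1 p, r1 p⟩

/-- Left restriction of an edge. -/
theorem FRel.left {p p' q : P} (h : FRel p p') (hq : PLe q p) : FRel q (q ⊛ p') := by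
  refine ⟨?_, ast_idem' q p'⟩
  rw [ast_times]
  calc q ⊠ p' = (p ⊠ q) ⊠ p' := by rw [hq.times_left]
    _ = (p ⊠ q) ⊠ (p ⊠ p') := l4 _ _ _
    _ = q := by rw [h.1, hq.times_left, hq.times_right]

/-- Right restriction of an edge. -/
theorem FRel.right {p p' q : P} (h : FRel p p') (hq : PLe q p') : FRel (p ⊠ q) q := by
  refine ⟨times_idem' p q, ?_⟩
  rw [times_ast]
  calc p ⊛ q = p ⊛ (q ⊛ p') := by rw [hq.ast_right]
    _ = (p ⊛ p') ⊛ (q ⊛ p') := r4 _ _ _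
    _ = q := by rw [h.2, hq.ast_right, hq.ast_left]

end Basic

section Strong
variable [StrongProjectionAlgebra P]
open ProjectionAlgebra StrongProjectionAlgebra

theorem sp1_le {e f g : P} (h : PLe g (e ⊠ f)) : e ⊠ (g ⊛ f) = g := by
  have h1 := sp1 e f g
  rwa [h.times_left] at h1

theorem sp2_le {e f g : P} (h : PLe g (f ⊛ e)) : (f ⊠ g) ⊛ e = g := by
  have h1 := sp2 e f g
  rwa [h.ast_right] at h1

theorem ast_times_eq (p s t : P) : (p ⊛ s) ⊠ t = (p ⊠ (s ⊠ t)) ⊛ s := by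
  rw [← p3' t s p, sp2_le (times_ple (p ⊛ s) t)]

theorem ast_times_eq' (p s t : P) : t ⊛ (s ⊠ p) = s ⊠ ((t ⊛ s) ⊛ p) := by
  rw [← p3 t s p, sp1_le (ast_ple t (s ⊠ p))]

end Strong

end ProjectionAlgebraLemmas

/-! The path category of a strong projection algebra -/

/-- A `P`-path: a nonempty list `(p₁, …, pₖ)` with `p₁ F p₂ F ⋯ F pₖ`. -/
@[ext]
structure PPath (P : Type u) [ProjOps P] where
  toList : List P
  ne_nil : toList ≠ []
  chain : toList.IsChain FRel

namespace PPath

variable {P : Type u}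

section Ops
variable [ProjOps P]

/-- The first object `p₁` of a path. -/
def dom (a : PPath P) : P := a.toList.head a.ne_nil

/-- The last object `pₖ` of a path. -/
def cod (a : PPath P) : P := a.toList.getLast a.ne_nil

/-- The path `(p)` of length `1`. -/
def single (p : P) : PPath P := ⟨[p], by simp, by simp⟩

/-- The path `(p, q)`. -/
def edge (p q : P) (h : FRel p q) : PPath P := ⟨[p, q], by simp, by simpa using h⟩

/-- The composite `(p₁, …, pₖ = q₁, q₂, …, qₗ)`. -/
def comp (a b : PPath P) (h : a.cod = b.dom) : PPath P where
  toList := a.toList ++ b.toList.tail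
  ne_nil := by simp [a.ne_nil]
  chain := by
    obtain ⟨l, hl, hc⟩ := a
    obtain ⟨m, hm, hd⟩ := b
    cases m with
    | nil => exact absurd rfl hm
    | cons x m =>
      rw [List.isChain_append]
      refine ⟨hc, hd.tail, ?_⟩
      intro y hy z hz
      rw [List.getLast?_eq_getLast_of_ne_nil hl] at hy
      simp only [cod, dom, List.head_cons] at h
      rw [h] at hy
      cases m with
      | nil => simp at hz
      | cons w m =>
        simp at hy hz
        subst hy hz
        simp at hd
        exact hd.1

end Ops

end PPath

section ListOps

variable {P : Type u}

/-- The running products `(x ⊛ p₁, (x ⊛ p₁) ⊛ p₂, …)`. -/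
def lrun [ProjOps P] : P → List P → List P
  | _, [] => []
  | x, p :: l => (x ⊛ p) :: lrun (x ⊛ p) l

/-- The running products `(…, pₖ₋₁ ⊠ (pₖ ⊠ x), pₖ ⊠ x)`. -/
def rrun [ProjOps P] : List P → P → List P
  | [], _ => []
  | p :: l, x => (p ⊠ l.foldr ProjOps.times x) :: rrun l x

theorem scanl_eq_lrun [ProjOps P] (x : P) (l : List P) :
    l.scanl ProjOps.ast x = x :: lrun x l := by
  induction l generalizing x with
  | nil => rfl
  | cons p l ih => simp [lrun, ih]

theorem scanr_eq_rrun [ProjOps P] (x : P) (l : List P) :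
    l.scanr ProjOps.times x = rrun l x ++ [x] := by
  induction l with
  | nil => rfl
  | cons p l ih => simp [rrun, ih]

theorem lrun_append [ProjOps P] (x : P) (l m : List P) :
    lrun x (l ++ m) = lrun x l ++ lrun (l.foldl ProjOps.ast x) m := by
  induction l generalizing x with
  | nil => rfl
  | cons p l ih => simp [lrun, ih]

theorem rrun_append [ProjOps P] (x : P) (l m : List P) :
    rrun (l ++ m) x = rrun l (m.foldr ProjOps.times x) ++ rrun m x := by
  induction l with
  | nil => rfl
  | cons p l ih => simp [rrun, ih]

variable [ProjectionAlgebra P]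
open ProjectionAlgebra

theorem lrun_chain {x p : P} {l : List P} (h : (p :: l).IsChain FRel) (hx : PLe x p) :
    (x :: lrun x l).IsChain FRel := by
  induction l generalizing x p with
  | nil => simp [lrun]
  | cons q l ih =>
    rw [List.isChain_cons_cons] at h
    rw [lrun, List.isChain_cons_cons]
    exact ⟨h.1.left hx, ih h.2 (ast_ple _ _)⟩

theorem rrun_chain (x : P) {l : List P} (h : l.IsChain FRel) : (rrun l x).IsChain FRel := by
  induction l with
  | nil => simp [rrun]
  | cons p l ih =>
    cases l with
    | nil => simp [rrun]
    | cons q l =>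
      rw [List.isChain_cons_cons] at h
      have := ih h.2
      rw [rrun] at this ⊢
      rw [rrun, List.isChain_cons_cons]
      exact ⟨h.1.right (times_ple _ _), this⟩

theorem rrun_append_self {x q : P} {l : List P} (h : (l ++ [q]).IsChain FRel) (hx : PLe x q) :
    (rrun l x ++ [x]).IsChain FRel := by
  have h1 := rrun_chain x h
  rwa [rrun_append, rrun, rrun, List.foldr_nil, hx.times_left, List.foldr_cons, List.foldr_nil,
    hx.times_left] at h1

end ListOps

namespace PPath

variable {P : Type u} [ProjectionAlgebra P]

/-- Left restriction of `(p₁, …, pₖ)` to `q ≤ p₁`: the path `(q₁, …, qₖ)` with `q₁ = q` and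
`qᵢ = qᵢ₋₁ ⊛ pᵢ`. -/
def leftRestrict (a : PPath P) (q : P) (h : PLe q a.dom) : PPath P where
  toList := a.toList.tail.scanl ProjOps.ast q
  ne_nil := by simp [scanl_eq_lrun]
  chain := by
    rw [scanl_eq_lrun]
    refine lrun_chain (p := a.dom) ?_ h
    have := a.chain
    rwa [← List.cons_head_tail a.ne_nil] at this

/-- Right restriction of `(p₁, …, pₖ)` to `q ≤ pₖ`: the path `(q₁, …, qₖ)` with `qₖ = q` and
`qᵢ = pᵢ ⊠ qᵢ₊₁`. -/
def rightRestrict (a : PPath P) (q : P) (h : PLe q a.cod) : PPath P where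
  toList := a.toList.dropLast.scanr ProjOps.times q
  ne_nil := by simp [scanr_eq_rrun]
  chain := by
    rw [scanr_eq_rrun]
    refine rrun_append_self (q := a.cod) ?_ h
    have := a.chain
    rwa [← List.dropLast_append_getLast a.ne_nil] at this

theorem leftRestrict_dom (a : PPath P) (q : P) (h : PLe q a.dom) :
    (a.leftRestrict q h).dom = q := by
  simp [leftRestrict, dom, scanl_eq_lrun]

theorem rightRestrict_cod (a : PPath P) (q : P) (h : PLe q a.cod) :
    (a.rightRestrict q h).cod = q := by
  simp [rightRestrict, cod, scanr_eq_rrun]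

/-- The product of two paths `a = (p₁, …, pₖ)` and `b = (q₁, …, qₗ)`, as the composite of the right
restriction of `a` to `pₖ ⊠ q₁`, the path `(pₖ ⊠ q₁, pₖ ⊛ q₁)`, and the left restriction of `b` to
`pₖ ⊛ q₁`. -/
def bullet (a b : PPath P) : PPath P :=
  ((a.rightRestrict (a.cod ⊠ b.dom) (times_ple _ _)).comp
    (edge (a.cod ⊠ b.dom) (a.cod ⊛ b.dom) (fRel_times_ast _ _))
      (by rw [rightRestrict_cod]; rfl)).comp
    (b.leftRestrict (a.cod ⊛ b.dom) (ast_ple _ _))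
      (by rw [leftRestrict_dom]; simp [cod, comp, edge])

theorem bullet_toList (a b : PPath P) :
    (a.bullet b).toList = rrun a.toList b.dom ++ lrun a.cod b.toList := by
  have ha : a.toList = a.toList.dropLast ++ [a.cod] :=
    (List.dropLast_append_getLast a.ne_nil).symm
  have hb : b.toList = b.dom :: b.toList.tail := (List.cons_head_tail b.ne_nil).symm
  conv_rhs => rw [ha, hb]
  simp [bullet, comp, rightRestrict, leftRestrict, edge, scanl_eq_lrun, scanr_eq_rrun,
    rrun_append, rrun, lrun]

end PPath

/-! The chain category of a strong projection algebra -/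

/-- `(e, p, f)` is an admissible triple. -/
def Admissible {P : Type u} [ProjOps P] (e p f : P) : Prop :=
  f = (e ⊛ p) ⊛ f ∧ e = e ⊠ (p ⊠ f)

/-- The generating pairs of paths: `((p, p), (p))`, and `((e, e ⊛ p, f), (e, p ⊠ f, f))` for an
admissible triple `(e, p, f)`. -/
inductive Omega {P : Type u} [ProjOps P] : PPath P → PPath P → Prop
  | idem (a b : PPath P) (p : P) (ha : a.toList = [p, p]) (hb : b.toList = [p]) : Omega a b
  | adm (a b : PPath P) (e p f : P) (h : Admissible e p f)
      (ha : a.toList = [e, e ⊛ p, f]) (hb : b.toList = [e, p ⊠ f, f]) : Omega a b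

/-- The least congruence on the path category that contains `Omega`. -/
inductive PathCongr {P : Type u} [ProjOps P] : PPath P → PPath P → Prop
  | of {a b : PPath P} : Omega a b → PathCongr a b
  | refl (a : PPath P) : PathCongr a a
  | symm {a b : PPath P} : PathCongr a b → PathCongr b a
  | trans {a b c : PPath P} : PathCongr a b → PathCongr b c → PathCongr a c
  | comp_left (c : PPath P) {a b : PPath P} (ha : c.cod = a.dom) (hb : c.cod = b.dom) :
      PathCongr a b → PathCongr (c.comp a ha) (c.comp b hb)
  | comp_right (c : PPath P) {a b : PPath P} (ha : a.cod = c.dom) (hb : b.cod = c.dom) :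
      PathCongr a b → PathCongr (a.comp c ha) (b.comp c hb)

/-- The congruence on paths as a setoid. -/
instance pathSetoid (P : Type u) [ProjOps P] : Setoid (PPath P) where
  r := PathCongr
  iseqv := ⟨PathCongr.refl, PathCongr.symm, PathCongr.trans⟩

/-- The set of chains `[p₁, …, pₖ]`, that is, of classes of paths. -/
def Chain (P : Type u) [ProjOps P] : Type u := Quotient (pathSetoid P)

/-! List version of the congruence -/

section ListStep

variable {P : Type u}

inductive Gen [ProjOps P] : List P → List P → Prop
  | idem (p : P) : Gen [p, p] [p]
  | adm (e p f : P) (h : Admissible e p f) : Gen [e, e ⊛ p, f] [e, p ⊠ f, f]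

inductive Step [ProjOps P] : List P → List P → Prop
  | mk (l m : List P) {x y : List P} (h : Gen x y) : Step (l ++ x ++ m) (l ++ y ++ m)

def LEqv [ProjOps P] : List P → List P → Prop := Relation.EqvGen Step

theorem LEqv.map [ProjOps P] {f : List P → List P}
    (hf : ∀ l m, Step l m → LEqv (f l) (f m)) {l m : List P} (h : LEqv l m) :
    LEqv (f l) (f m) := by
  induction h with
  | rel _ _ h => exact hf _ _ h
  | refl _ => exact .refl _
  | symm _ _ _ ih => exact .symm _ _ ih
  | trans _ _ _ _ _ ih1 ih2 => exact .trans _ _ _ ih1 ih2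

theorem LEqv.context [ProjOps P] (l m : List P) {x y : List P} (h : LEqv x y) :
    LEqv (l ++ x ++ m) (l ++ y ++ m) := by
  refine LEqv.map (f := fun z => l ++ z ++ m) ?_ h
  rintro _ _ ⟨l', m', hg⟩
  have := Step.mk (l ++ l') (m' ++ m) hg
  exact .rel _ _ (by simpa using this)

theorem Gen.ends [ProjOps P] {x y : List P} (h : Gen x y) :
    x.head? = y.head? ∧ x.getLast? = y.getLast? ∧ x ≠ [] ∧ y ≠ [] := by
  cases h <;> simp

theorem LEqv.ends [ProjOps P] {x y : List P} (h : LEqv x y) :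
    x.head? = y.head? ∧ x.getLast? = y.getLast? := by
  induction h with
  | rel _ _ h =>
    obtain ⟨l, m, hg⟩ := h
    obtain ⟨h1, h2, -, -⟩ := hg.ends
    simp [List.head?_append, List.getLast?_append, h1, h2]
  | refl _ => simp
  | symm _ _ _ ih => exact ⟨ih.1.symm, ih.2.symm⟩
  | trans _ _ _ _ _ ih1 ih2 => exact ⟨ih1.1.trans ih2.1, ih1.2.trans ih2.2⟩

variable [StrongProjectionAlgebra P]
open ProjectionAlgebra StrongProjectionAlgebra

theorem Admissible.chain {e p f : P} (h : Admissible e p f) :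
    [e, e ⊛ p, f].IsChain FRel ∧ [e, p ⊠ f, f].IsChain FRel := by
  obtain ⟨h1, h2⟩ := h
  have hep : e ⊠ p = e := by
    have : e ⊠ (p ⊠ f) = (e ⊠ p) ⊠ (p ⊠ f) := l3 _ _ _
    rw [← h2] at this
    have h3 : PLe e (e ⊠ p) := by
      have h4 := times_ple (e ⊠ p) (p ⊠ f)
      rwa [← this] at h4
    have h5 := h3.times_left
    rwa [l2] at h5
  have hpf : p ⊛ f = f := by
    have : (e ⊛ p) ⊛ f = (e ⊛ p) ⊛ (p ⊛ f) := r3 _ _ _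
    rw [← h1] at this
    have h3 : PLe f (p ⊛ f) := by
      have h4 := ast_ple (e ⊛ p) (p ⊛ f)
      rwa [← this] at h4
    have h5 := h3.ast_right
    rwa [← r2] at h5
  constructor
  · simp only [List.isChain_cons_cons, List.isChain_singleton, and_true]
    refine ⟨⟨by rw [ast_times, hep], ast_idem' _ _⟩, ?_, h1.symm⟩
    rw [ast_times_eq, ← h2]
  · simp only [List.isChain_cons_cons, List.isChain_singleton, and_true]
    refine ⟨⟨h2.symm, ?_⟩, times_idem' _ _, by rw [times_ast, hpf]⟩
    rw [ast_times_eq', ← h1]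

theorem Gen.chain {x y : List P} (h : Gen x y) : x.IsChain FRel ∧ y.IsChain FRel := by
  cases h with
  | idem p => simpa using fRel_self p
  | adm e p f h => exact h.chain

theorem Step.chain_iff {x y : List P} (h : Step x y) : x.IsChain FRel ↔ y.IsChain FRel := by
  obtain ⟨l, m, hg⟩ := h
  obtain ⟨h1, h2, -, -⟩ := hg.ends
  simp [List.isChain_append, hg.chain.1, hg.chain.2, h1, h2]

theorem LEqv.chain_iff {x y : List P} (h : LEqv x y) : x.IsChain FRel ↔ y.IsChain FRel := by
  induction h with
  | rel _ _ h => exact h.chain_iff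
  | refl _ => rfl
  | symm _ _ _ ih => exact ih.symm
  | trans _ _ _ _ _ ih1 ih2 => exact ih1.trans ih2

theorem Step.congr {a b : PPath P} (h : Step a.toList b.toList) : PathCongr a b := by
  obtain ⟨la, ha, hca⟩ := a
  obtain ⟨lb, hb, hcb⟩ := b
  obtain ⟨l, m, hg⟩ := h
  rename_i x y
  obtain ⟨h1, h2, hx, hy⟩ := hg.ends
  let px : PPath P := ⟨x, hx, hg.chain.1⟩
  let py : PPath P := ⟨y, hy, hg.chain.2⟩
  have hd : px.dom = py.dom := by
    rw [List.head?_eq_some_head hx, List.head?_eq_some_head hy] at h1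
    exact Option.some.inj h1
  have hc : px.cod = py.cod := by
    rw [List.getLast?_eq_some_getLast hx, List.getLast?_eq_some_getLast hy] at h2
    exact Option.some.inj h2
  have hp : PathCongr px py := by
    refine .of ?_
    cases hg with
    | idem p => exact .idem _ _ p rfl rfl
    | adm e p f h => exact .adm _ _ e p f h rfl rfl
  have ex : x = px.dom :: x.tail := (List.cons_head_tail hx).symm
  have ex' : x = x.dropLast ++ [px.cod] := (List.dropLast_append_getLast hx).symm
  let pl : PPath P := ⟨l ++ [px.dom], by simp, by
    rw [ex] at hca
    exact hca.prefix ⟨x.tail ++ m, by simp⟩⟩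
  let pm : PPath P := ⟨px.cod :: m, by simp, by
    rw [ex'] at hca
    exact hca.suffix ⟨l ++ x.dropLast, by simp⟩⟩
  have k := PathCongr.comp_left pl (a := px.comp pm rfl) (b := py.comp pm hc.symm)
    (by simp [pl, PPath.cod, PPath.comp, PPath.dom, px, hx])
    (by
      rw [show pl.cod = px.dom by simp [pl, PPath.cod], hd]
      simp [PPath.comp, PPath.dom, py, hy]) (hp.comp_right pm rfl hc.symm)
  convert k using 1
  · ext1
    simp only [PPath.comp, pl, pm, px, List.tail_cons, List.append_assoc]
    conv_lhs => rw [ex]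
    simp [List.tail_append_of_ne_nil, hx, px]
  · ext1
    have ey : y = py.dom :: y.tail := (List.cons_head_tail hy).symm
    simp only [PPath.comp, pl, pm, py, List.tail_cons, List.append_assoc]
    conv_lhs => rw [ey, ← hd]
    simp [List.tail_append_of_ne_nil, hy]

theorem LEqv.congr_aux {x y : List P} (h : LEqv x y) :
    ∀ (hx : x ≠ []) (hcx : x.IsChain FRel) (hy : y ≠ []) (hcy : y.IsChain FRel),
      PathCongr (⟨x, hx, hcx⟩ : PPath P) ⟨y, hy, hcy⟩ := by
  induction h with
  | rel _ _ h => intros; exact Step.congr h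
  | refl _ => intros; exact .refl _
  | symm _ _ _ ih => intros; exact .symm (ih _ _ _ _)
  | trans x y z h1 h2 ih1 ih2 =>
    intro hx hcx hz hcz
    have hy : y ≠ [] := by
      intro hy
      subst hy
      have := (LEqv.ends h1).1
      simp [hx] at this
    exact .trans (ih1 hx hcx hy ((LEqv.chain_iff h1).1 hcx)) (ih2 _ _ _ _)

theorem LEqv.congr {a b : PPath P} (h : LEqv a.toList b.toList) : PathCongr a b :=
  h.congr_aux _ _ _ _

theorem PathCongr.leqv {a b : PPath P} (h : PathCongr a b) :
    LEqv a.toList b.toList := by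
  induction h with
  | of h =>
    refine .rel _ _ ?_
    cases h with
    | idem p ha hb => rw [ha, hb]; exact Step.mk [] [] (.idem p)
    | adm e p f h ha hb =>
      rw [ha, hb]; exact Step.mk [] [] (.adm e p f h)
  | refl _ => exact .refl _
  | symm _ ih => exact .symm _ _ ih
  | trans _ _ ih1 ih2 => exact .trans _ _ _ ih1 ih2
  | @comp_left c a b ha hb _ ih =>
    have hc := List.dropLast_append_getLast c.ne_nil
    have e1 : (c.comp a ha).toList = c.toList.dropLast ++ a.toList ++ [] := by
      change c.toList ++ a.toList.tail = _
      conv_lhs => rw [← hc]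
      conv_rhs => rw [← List.cons_head_tail a.ne_nil]
      have : c.toList.getLast c.ne_nil = a.toList.head a.ne_nil := ha
      simp [this]
    have e2 : (c.comp b hb).toList = c.toList.dropLast ++ b.toList ++ [] := by
      change c.toList ++ b.toList.tail = _
      conv_lhs => rw [← hc]
      conv_rhs => rw [← List.cons_head_tail b.ne_nil]
      have : c.toList.getLast c.ne_nil = b.toList.head b.ne_nil := hb
      simp [this]
    rw [e1, e2]
    exact ih.context _ _
  | @comp_right c a b ha hb _ ih => exact ih.context [] c.toList.tail

theorem pathCongr_iff {a b : PPath P} : PathCongr a b ↔ LEqv a.toList b.toList :=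
  ⟨PathCongr.leqv, LEqv.congr⟩

theorem PathCongr.dom_eq {a b : PPath P} (h : PathCongr a b) : a.dom = b.dom := by
  have := h.leqv.ends.1
  rw [List.head?_eq_some_head a.ne_nil, List.head?_eq_some_head b.ne_nil] at this
  exact Option.some.inj this

theorem PathCongr.cod_eq {a b : PPath P} (h : PathCongr a b) : a.cod = b.cod := by
  have := h.leqv.ends.2
  rw [List.getLast?_eq_some_getLast a.ne_nil, List.getLast?_eq_some_getLast b.ne_nil] at this
  exact Option.some.inj this

end ListStep

section Products

variable {P : Type u} [StrongProjectionAlgebra P]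
open ProjectionAlgebra StrongProjectionAlgebra

theorem Gen.rrun {x y : List P} (h : Gen x y) (z : P) :
    Gen (rrun x z) (rrun y z) ∧ x.foldr ProjOps.times z = y.foldr ProjOps.times z := by
  cases h with
  | idem p =>
    simp only [ChainSG.rrun, List.foldr_cons, List.foldr_nil, times_idem, and_true]
    exact .idem _
  | adm e p f h =>
    have h1 : e ⊠ ((e ⊛ p) ⊠ (f ⊠ z)) = e ⊠ (p ⊠ (f ⊠ z)) := p3' _ _ _
    have h2 : (p ⊠ f) ⊠ (f ⊠ z) = p ⊠ (f ⊠ z) := (l3 _ _ _).symm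
    simp only [ChainSG.rrun, List.foldr_cons, List.foldr_nil, h1, h2, and_true]
    rw [ast_times_eq e p (f ⊠ z)]
    refine .adm _ _ _ ⟨?_, ?_⟩
    · rw [← ast_times_eq e p (f ⊠ z), times_ast, ast_times_eq', ← h.1, ast_times]
    · exact (times_idem' _ _).symm

theorem Gen.lrun {x y : List P} (h : Gen x y) (z : P) :
    Gen (lrun z x) (lrun z y) ∧ x.foldl ProjOps.ast z = y.foldl ProjOps.ast z := by
  cases h with
  | idem p =>
    simp only [ChainSG.lrun, List.foldl_cons, List.foldl_nil, ast_idem, and_true]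
    exact .idem _
  | adm e p f h =>
    have h1 : ((z ⊛ e) ⊛ (p ⊠ f)) ⊛ f = ((z ⊛ e) ⊛ p) ⊛ f := p3 _ _ _
    have h2 : (z ⊛ e) ⊛ (e ⊛ p) = (z ⊛ e) ⊛ p := (r3 _ _ _).symm
    simp only [ChainSG.lrun, List.foldl_cons, List.foldl_nil, h1, h2, and_true]
    rw [ast_times_eq' f p (z ⊛ e)]
    refine .adm _ _ _ ⟨(ast_idem' _ _).symm, ?_⟩
    rw [← ast_times_eq' f p (z ⊛ e), ast_times]
    have he := ast_ple z e
    calc z ⊛ e = (e ⊠ (z ⊛ e)) ⊠ e := by rw [he.times_left, he.times_right]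
      _ = (e ⊠ (z ⊛ e)) ⊠ (e ⊠ (p ⊠ f)) := by rw [← h.2]
      _ = (e ⊠ (z ⊛ e)) ⊠ (p ⊠ f) := (l4 _ _ _).symm
      _ = _ := by rw [he.times_left]

theorem LEqv.rrun {l m : List P} (h : LEqv l m) (z : P) : LEqv (rrun l z) (rrun m z) := by
  refine LEqv.map (f := fun l => ChainSG.rrun l z) ?_ h
  rintro _ _ ⟨l, m, hg⟩
  simp only [rrun_append]
  obtain ⟨h1, h2⟩ := hg.rrun (m.foldr ProjOps.times z)
  rw [h2]
  exact .rel _ _ (.mk _ _ h1)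

theorem LEqv.lrun {l m : List P} (h : LEqv l m) (z : P) : LEqv (lrun z l) (lrun z m) := by
  refine LEqv.map (f := fun l => ChainSG.lrun z l) ?_ h
  rintro _ _ ⟨l, m, hg⟩
  simp only [lrun_append, List.foldl_append]
  obtain ⟨h1, h2⟩ := hg.lrun (l.foldl ProjOps.ast z)
  rw [h2]
  exact .rel _ _ (.mk _ _ h1)

theorem LEqv.append {l l' m m' : List P} (h : LEqv l l') (k : LEqv m m') :
    LEqv (l ++ m) (l' ++ m') := by
  have h1 := h.context [] m
  have h2 := k.context l' []
  simp only [List.nil_append, List.append_nil] at h1 h2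
  exact .trans _ _ _ h1 h2

theorem bullet_congr {a a' b b' : PPath P} (ha : PathCongr a a') (hb : PathCongr b b') :
    PathCongr (a.bullet b) (a'.bullet b') := by
  refine LEqv.congr ?_
  rw [PPath.bullet_toList, PPath.bullet_toList, ha.cod_eq, hb.dom_eq]
  exact (ha.leqv.rrun _).append (hb.leqv.lrun _)

/-! Identities for the running products -/

theorem foldr_lrun (p s : P) (b : List P) :
    p ⊠ (lrun p b).foldr ProjOps.times s = p ⊠ b.foldr ProjOps.times s := by
  induction b generalizing p with
  | nil => rfl
  | cons q b ih => rw [lrun, List.foldr_cons, ih, p3', List.foldr_cons]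

theorem foldl_rrun (p s : P) (b : List P) :
    (rrun b s).foldl ProjOps.ast p ⊛ s = b.foldl ProjOps.ast p ⊛ s := by
  induction b using List.reverseRecOn generalizing s with
  | nil => rfl
  | append_singleton b q ih =>
    simp only [rrun_append, rrun, List.foldr_cons, List.foldr_nil, List.foldl_append,
      List.foldl_cons, List.foldl_nil]
    rw [ih, p3]

theorem foldl_times (q y : P) (l : List P) :
    l.foldl ProjOps.ast q ⊠ y = l.foldl ProjOps.ast (q ⊠ l.foldr ProjOps.times y) := by
  induction l generalizing q with
  | nil => rfl
  | cons p l ih => rw [List.foldl_cons, ih, ast_times_eq]; rfl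

theorem ast_foldr (q y : P) (l : List P) :
    y ⊛ l.foldr ProjOps.times q = l.foldr ProjOps.times (l.foldl ProjOps.ast y ⊛ q) := by
  induction l generalizing y with
  | nil => rfl
  | cons p l ih => rw [List.foldr_cons, ast_times_eq', ih]; rfl

theorem rrun_rrun {q z w pk : P} (a : List P) (h : (pk ⊠ q) ⊠ z = pk ⊠ w) :
    rrun (rrun (a ++ [pk]) q) z = rrun (a ++ [pk]) w := by
  suffices H : ∀ a : List P, rrun (rrun (a ++ [pk]) q) z = rrun (a ++ [pk]) w ∧
      (rrun (a ++ [pk]) q).foldr ProjOps.times z = (a ++ [pk]).foldr ProjOps.times w ∧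
      PLe ((a ++ [pk]).foldr ProjOps.times w) ((a ++ [pk]).foldr ProjOps.times q) from (H a).1
  clear a
  intro a
  induction a with
  | nil =>
    simp only [List.nil_append, rrun, List.foldr_nil, List.foldr_cons, h, true_and]
    rw [← h]
    exact times_ple _ _
  | cons p a ih =>
    obtain ⟨h1, h2, h3⟩ := ih
    have h4 : (p ⊠ (a ++ [pk]).foldr ProjOps.times q) ⊠ (a ++ [pk]).foldr ProjOps.times w =
        p ⊠ (a ++ [pk]).foldr ProjOps.times w := by
      conv_lhs => rw [← h3.times_left, ← l3, h3.times_left]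
    simp only [List.cons_append, rrun, List.foldr_cons, h1, h2, h4, true_and]
    rw [← h4]
    exact times_ple _ _

theorem lrun_lrun {x t w s : P} (c : List P) (h : x ⊛ (t ⊛ s) = w ⊛ s) :
    lrun x (lrun t (s :: c)) = lrun w (s :: c) := by
  induction c generalizing x t w s with
  | nil => simp [lrun, h]
  | cons s' c ih =>
    have h2 : (x ⊛ (t ⊛ s)) ⊛ ((t ⊛ s) ⊛ s') = (w ⊛ s) ⊛ s' := by
      rw [← h, ← r3]
    have := ih h2
    calc lrun x (lrun t (s :: s' :: c))
        = (x ⊛ (t ⊛ s)) :: lrun (x ⊛ (t ⊛ s)) (lrun (t ⊛ s) (s' :: c)) := rfl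
      _ = (w ⊛ s) :: lrun (w ⊛ s) (s' :: c) := by rw [this, h]
      _ = lrun w (s :: s' :: c) := rfl

theorem rrun_lrun (p s : P) (b : List P) :
    rrun (lrun p b) s = lrun (p ⊠ b.foldr ProjOps.times s) b := by
  induction b generalizing p with
  | nil => rfl
  | cons q b ih =>
    have h : (p ⊠ (q ⊠ b.foldr ProjOps.times s)) ⊛ q = (p ⊛ q) ⊠ b.foldr ProjOps.times s :=
      (ast_times_eq _ _ _).symm
    rw [lrun, rrun, ih, foldr_lrun, List.foldr_cons, lrun, h]

theorem lrun_rrun (p s : P) (b : List P) :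
    lrun p (rrun b s) = rrun b (b.foldl ProjOps.ast p ⊛ s) := by
  induction b using List.reverseRecOn generalizing s with
  | nil => rfl
  | append_singleton b q ih =>
    have h : q ⊠ ((b.foldl ProjOps.ast p ⊛ q) ⊛ s) = b.foldl ProjOps.ast p ⊛ (q ⊠ s) :=
      (ast_times_eq' _ _ _).symm
    simp only [rrun_append, lrun_append, rrun, lrun, List.foldr_cons, List.foldr_nil,
      List.foldl_append, List.foldl_cons, List.foldl_nil]
    rw [ih, foldl_rrun, h]

theorem zigzag (e f : P) (b : List P) (h1 : f = b.foldl ProjOps.ast e ⊛ f)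
    (h2 : e = e ⊠ b.foldr ProjOps.times f) :
    LEqv (e :: (lrun e b ++ [f])) (e :: (rrun b f ++ [f])) := by
  induction b generalizing e with
  | nil => exact .refl _
  | cons q b ih =>
    set D := b.foldr ProjOps.times f with hD
    have h2' : e = e ⊠ (q ⊠ D) := h2
    have h3 : e ⊛ q = (e ⊛ q) ⊠ D := by rw [ast_times_eq, ← h2']
    have h4 : D = (e ⊛ q) ⊛ D := by
      rw [hD, ast_foldr]
      congr 1
    have k1 := (ih (e ⊛ q) h1 h3).context [e] []
    have hg : Gen [e, e ⊛ q, D] [e, q ⊠ D, D] := .adm _ _ _ ⟨h4, h2'⟩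
    have k2 : LEqv (e :: (e ⊛ q) :: (rrun b f ++ [f])) (e :: (q ⊠ D) :: (rrun b f ++ [f])) := by
      cases b with
      | nil => exact .rel _ _ (Step.mk [] [] hg)
      | cons r b =>
        have := Step.mk [] (rrun b f ++ [f]) hg
        exact .rel _ _ (by simpa [rrun, hD] using this)
    have k3 : LEqv (e :: (lrun e (q :: b) ++ [f])) (e :: (e ⊛ q) :: (rrun b f ++ [f])) := by
      simpa [lrun] using k1
    exact .trans _ _ _ k3 k2

end Products

theorem PPath.bullet_dom {P : Type u} [StrongProjectionAlgebra P] (a b : PPath P) :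
    (a.bullet b).dom = a.toList.foldr ProjOps.times b.dom := by
  obtain ⟨l, hl, hc⟩ := a
  cases l with
  | nil => exact absurd rfl hl
  | cons p l => simp [PPath.dom, PPath.bullet_toList, rrun]

theorem PPath.bullet_cod {P : Type u} [StrongProjectionAlgebra P] (a b : PPath P) :
    (a.bullet b).cod = b.toList.foldl ProjOps.ast a.cod := by
  obtain ⟨l, hl, hc⟩ := b
  cases l using List.reverseRecOn with
  | nil => exact absurd rfl hl
  | append_singleton l p => simp [PPath.cod, PPath.bullet_toList, lrun_append, lrun]

theorem bullet_assoc {P : Type u} [StrongProjectionAlgebra P] (a b c : PPath P) :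
    PathCongr ((a.bullet b).bullet c) (a.bullet (b.bullet c)) := by
  refine LEqv.congr ?_
  have ha := List.dropLast_append_getLast a.ne_nil
  have hb := List.cons_head_tail b.ne_nil
  have hb' := List.dropLast_append_getLast b.ne_nil
  have hc := List.cons_head_tail c.ne_nil
  change _ ++ [a.cod] = _ at ha
  change _ ++ [b.cod] = _ at hb'
  change b.dom :: _ = _ at hb
  change c.dom :: _ = _ at hc
  simp only [PPath.bullet_toList, PPath.bullet_dom, PPath.bullet_cod]
  rw [rrun_append, lrun_append]
  have e1 : rrun (rrun a.toList b.dom) ((lrun a.cod b.toList).foldr ProjOps.times c.dom) =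
      rrun a.toList (b.toList.foldr ProjOps.times c.dom) := by
    rw [← ha]
    refine rrun_rrun _ ?_
    rw [ProjectionAlgebra.l4, foldr_lrun, ← ProjectionAlgebra.l4]
    rw [← hb, List.foldr_cons, ← ProjectionAlgebra.l3]
  have e2 : lrun ((rrun b.toList c.dom).foldl ProjOps.ast a.cod) (lrun b.cod c.toList) =
      lrun (b.toList.foldl ProjOps.ast a.cod) c.toList := by
    rw [← hc]
    refine lrun_lrun _ ?_
    rw [ProjectionAlgebra.r4, foldl_rrun, ← ProjectionAlgebra.r4]
    rw [← hb']
    simp only [List.foldl_append, List.foldl_cons, List.foldl_nil]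
    rw [← ProjectionAlgebra.r3]
  rw [e1, e2, rrun_lrun, lrun_rrun]
  set W := b.toList.foldr ProjOps.times c.dom with hW
  set Y := b.toList.foldl ProjOps.ast a.cod with hY
  have z := zigzag (a.cod ⊠ W) (Y ⊛ c.dom) b.toList
    (by rw [← foldl_times, times_ast_ast]) (by rw [← ast_foldr, times_times_ast])
  have z2 := z.context (rrun a.toList.dropLast (a.cod ⊠ W))
    (lrun (Y ⊛ c.dom) c.toList.tail)
  rw [← hc, ← ha]
  simpa [rrun_append, rrun, lrun] using z2

/-! DRC-restriction semigroups -/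

/-- DRC semigroups; `dplus x` is `x⁺` and `dstar x` is `x*`. -/
class DRCSemigroup (S : Type u) extends Semigroup S where
  dplus : S → S
  dstar : S → S
  plus_mul : ∀ x : S, dplus x * x = x
  mul_star : ∀ x : S, x * dstar x = x
  plus_congr : ∀ x y : S, dplus (x * y) = dplus (x * dplus y)
  star_congr : ∀ x y : S, dstar (x * y) = dstar (dstar x * y)
  plus_sandwich : ∀ x y : S, dplus (x * y) = dplus x * dplus (x * y) * dplus x
  star_sandwich : ∀ x y : S, dstar (x * y) = dstar y * dstar (x * y) * dstar y
  plus_plus : ∀ x : S, dplus (dplus x) = dplus x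
  star_star : ∀ x : S, dstar (dstar x) = dstar x
  star_plus : ∀ x : S, dstar (dplus x) = dplus x
  plus_star : ∀ x : S, dplus (dstar x) = dstar x

/-- DRC-restriction semigroups: DRC semigroups that satisfy the DRC-ample conditions. -/
class DRCRestrictionSemigroup (S : Type u) extends DRCSemigroup S where
  ample_right : ∀ x y : S, x * dstar (y * x) = dstar (y * dplus x) * x
  ample_left : ∀ x y : S, dplus (x * y) * x = x * dplus (dstar x * y)

/-- The set of projections `P(S) = {x⁺ | x ∈ S}`. -/
def Proj (S : Type u) [DRCSemigroup S] : Type u := {e : S // ∃ x, DRCSemigroup.dplus x = e}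

namespace Proj

open DRCSemigroup DRCRestrictionSemigroup

section DRC
variable {S : Type u} [DRCSemigroup S]

@[ext]
theorem ext {e f : Proj S} (h : e.1 = f.1) : e = f := Subtype.ext h

theorem plus_val (e : Proj S) : dplus e.1 = e.1 := by
  obtain ⟨_, x, rfl⟩ := e
  exact plus_plus x

theorem star_val (e : Proj S) : dstar e.1 = e.1 := by
  obtain ⟨_, x, rfl⟩ := e
  exact star_plus x

theorem mul_self (e : Proj S) : e.1 * e.1 = e.1 := by
  have := plus_mul e.1
  rwa [plus_val] at this

/-- The operations `e ⊠ f = (ef)⁺` and `e ⊛ f = (ef)*` on the set of projections. -/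
instance : ProjOps (Proj S) where
  times e f := ⟨dplus (e.1 * f.1), _, rfl⟩
  ast e f := ⟨dstar (e.1 * f.1), dstar (e.1 * f.1), plus_star _⟩

theorem times_val (e f : Proj S) : (e ⊠ f).1 = dplus (e.1 * f.1) := rfl

theorem ast_val (e f : Proj S) : (e ⊛ f).1 = dstar (e.1 * f.1) := rfl

theorem times_mul_left (e f : Proj S) : (e ⊠ f).1 * e.1 = (e ⊠ f).1 := by
  rw [times_val, plus_sandwich, plus_val, mul_assoc, mul_self]

theorem mul_times_left (e f : Proj S) : e.1 * (e ⊠ f).1 = (e ⊠ f).1 := by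
  rw [times_val, plus_sandwich, plus_val, ← mul_assoc, ← mul_assoc, mul_self]

theorem ast_mul_right (e f : Proj S) : (e ⊛ f).1 * f.1 = (e ⊛ f).1 := by
  rw [ast_val, star_sandwich, star_val, mul_assoc, mul_self]

theorem mul_ast_right (e f : Proj S) : f.1 * (e ⊛ f).1 = (e ⊛ f).1 := by
  rw [ast_val, star_sandwich, star_val, ← mul_assoc, ← mul_assoc, mul_self]

theorem times_mul (e f : Proj S) : (e ⊠ f).1 * f.1 = e.1 * f.1 := by
  rw [← times_mul_left, mul_assoc, times_val, plus_mul]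

theorem mul_ast (e f : Proj S) : e.1 * (e ⊛ f).1 = e.1 * f.1 := by
  rw [← mul_ast_right, ← mul_assoc, ast_val, mul_star]

theorem plus_mul_times (x : S) (f g : Proj S) :
    dplus (x * (f ⊠ g).1) = dplus (x * f.1 * g.1) := by
  rw [times_val, ← plus_congr, mul_assoc]

theorem star_ast_mul (x : S) (e f : Proj S) :
    dstar ((e ⊛ f).1 * x) = dstar (e.1 * f.1 * x) := by
  rw [ast_val, ← star_congr]

instance : ProjectionAlgebra (Proj S) where
  l1 e := by ext; rw [times_val, mul_self, plus_val]
  l2 e f := by ext; rw [times_val, times_mul_left, plus_val]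
  l3 e f g := by
    ext; rw [times_val, times_val (e ⊠ f), plus_mul_times, plus_mul_times, times_mul]
  l4 e f g := by
    ext; rw [times_val, times_val (e ⊠ f), plus_mul_times, times_mul_left]
  r1 e := by ext; rw [ast_val, mul_self, star_val]
  r2 e f := by ext; rw [ast_val e, mul_ast_right, star_val]
  r3 e f g := by
    ext; rw [ast_val, ast_val (g ⊛ f), star_ast_mul, star_ast_mul, mul_assoc, mul_assoc, mul_ast]
  r4 e f g := by
    ext; rw [ast_val, ast_val (g ⊛ e), star_ast_mul, mul_assoc, mul_ast_right]
  p3 e f g := by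
    ext; rw [ast_val, ast_val (e ⊛ f), star_ast_mul, star_ast_mul, mul_assoc, mul_assoc, times_mul]
  p3' e f g := by
    ext; rw [times_val, times_val g, plus_mul_times, plus_mul_times, mul_ast]
  p4 e f := by ext; rw [ast_val, times_mul_left, star_val]
  p4' e f := by ext; rw [times_val, mul_ast_right, plus_val]

end DRC

/-- The projections of a DRC-restriction semigroup form a strong projection algebra. -/
instance {S : Type u} [DRCRestrictionSemigroup S] : StrongProjectionAlgebra (Proj S) where
  sp1 e f g := by
    set h := (e ⊠ f) ⊠ g with hh
    have a1 : h.1 * (e ⊠ f).1 = h.1 := times_mul_left _ _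
    have a2 : h.1 * (e.1 * f.1) = h.1 * f.1 := by
      rw [← times_mul, ← mul_assoc, a1]
    have a3 := ample_right (e.1 * f.1) h.1
    rw [a2, ← times_val e f, a1, star_val, a2, ← ast_val, mul_assoc, mul_ast_right] at a3
    ext
    rw [times_val, a3, ← a2, plus_congr, ← times_val e f, a1, plus_val]
  sp2 e f g := by
    set h := g ⊛ (f ⊛ e) with hh
    have a1 : (f ⊛ e).1 * h.1 = h.1 := mul_ast_right _ _
    have a2 : f.1 * e.1 * h.1 = f.1 * h.1 := by
      rw [← mul_ast, mul_assoc, a1]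
    have a3 := ample_left (f.1 * e.1) h.1
    rw [a2, ← ast_val f e, a1, plus_val, a2, ← times_val, ← mul_assoc, times_mul_left] at a3
    ext
    rw [ast_val, a3, ← a2, star_congr, ← ast_val f e, a1, star_val]

end Proj

/-! The chain semigroup of a strong projection algebra -/

namespace Chain

variable {P : Type u}

/-- The chain `[p₁, …, pₖ]` of a path. -/
def mk [ProjOps P] (a : PPath P) : Chain P := Quotient.mk _ a

/-- The chain `[p]`. -/
def single [ProjOps P] (p : P) : Chain P := mk (PPath.single p)

variable [StrongProjectionAlgebra P]

theorem mk_eq_iff {a b : PPath P} : mk a = mk b ↔ LEqv a.toList b.toList :=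
  Quotient.eq.trans pathCongr_iff

/-- The product of chains, induced by the product of paths. -/
def mul (x y : Chain P) : Chain P :=
  Quotient.map₂ PPath.bullet (fun _ _ h _ _ k => bullet_congr h k) x y

/-- `[p₁, …, pₖ]⁺ = [p₁]`. -/
def plus (x : Chain P) : Chain P :=
  Quotient.lift (fun a => single a.dom) (fun _ _ h => congrArg single (PathCongr.dom_eq h)) x

/-- `[p₁, …, pₖ]* = [pₖ]`. -/
def star (x : Chain P) : Chain P :=
  Quotient.lift (fun a => single a.cod) (fun _ _ h => congrArg single (PathCongr.cod_eq h)) x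

theorem mul_mk (a b : PPath P) : mul (mk a) (mk b) = mk (a.bullet b) := rfl

theorem plus_mk (a : PPath P) : plus (mk a) = single a.dom := rfl

theorem star_mk (a : PPath P) : star (mk a) = single a.cod := rfl

theorem ind {C : Chain P → Prop} (h : ∀ a, C (mk a)) (x : Chain P) : C x := Quotient.inductionOn x h

theorem leqv_double (p : P) : LEqv [p, p] [p] := .rel _ _ (Step.mk [] [] (.idem p))

theorem single_mul_mk {t : P} {a : PPath P} (h : PLe t a.dom) :
    mul (single t) (mk a) = mk (a.leftRestrict t h) := by
  refine mk_eq_iff.2 ?_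
  have ha : a.dom :: a.toList.tail = a.toList := List.cons_head_tail a.ne_nil
  rw [PPath.bullet_toList]
  simp only [PPath.single, PPath.cod, List.getLast_singleton, PPath.leftRestrict, scanl_eq_lrun,
    rrun, List.foldr_nil]
  rw [← ha, lrun, h.ast_right, h.times_right]
  exact (leqv_double t).context [] _

theorem mk_mul_single {t : P} {a : PPath P} (h : PLe t a.cod) :
    mul (mk a) (single t) = mk (a.rightRestrict t h) := by
  refine mk_eq_iff.2 ?_
  have ha : a.toList.dropLast ++ [a.cod] = a.toList := List.dropLast_append_getLast a.ne_nil
  rw [PPath.bullet_toList]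
  simp only [PPath.single, PPath.dom, List.head_cons, PPath.rightRestrict, scanr_eq_rrun, lrun]
  rw [← ha, rrun_append]
  simp only [rrun, List.foldr_cons, List.foldr_nil]
  rw [h.times_left, h.ast_left]
  have := (leqv_double t).context (rrun a.toList.dropLast t) []
  simpa using this

theorem leftRestrict_self (a : PPath P) (h : PLe a.dom a.dom) : a.leftRestrict a.dom h = a := by
  obtain ⟨l, hl, hc⟩ := a
  cases l with
  | nil => exact absurd rfl hl
  | cons p l =>
    ext1
    simp only [PPath.leftRestrict, PPath.dom, List.head_cons, List.tail_cons, scanl_eq_lrun]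
    congr 1
    clear hl h
    induction l generalizing p with
    | nil => rfl
    | cons q l ih =>
      rw [List.isChain_cons_cons] at hc
      rw [lrun, hc.1.2, ih _ hc.2]

theorem rrun_self {l : List P} (hl : l ≠ []) (hc : l.IsChain FRel) :
    rrun l (l.getLast hl) = l := by
  induction l with
  | nil => exact absurd rfl hl
  | cons p l ih =>
    cases l with
    | nil => simp [rrun, ProjectionAlgebra.l1]
    | cons q l =>
      rw [List.isChain_cons_cons] at hc
      have h1 := ih (by simp) hc.2
      rw [List.getLast_cons (by simp), rrun, h1]
      rw [rrun] at h1
      rw [List.foldr_cons, (List.cons.inj h1).1, hc.1.1]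

theorem rightRestrict_toList (a : PPath P) (q : P) (h : PLe q a.cod) :
    (a.rightRestrict q h).toList = rrun a.toList q := by
  have ha : a.toList.dropLast ++ [a.cod] = a.toList := List.dropLast_append_getLast a.ne_nil
  change a.toList.dropLast.scanr ProjOps.times q = _
  rw [scanr_eq_rrun]
  conv_rhs => rw [← ha, rrun_append]
  simp only [rrun, List.foldr_cons, List.foldr_nil, h.times_left]

theorem leftRestrict_toList (a : PPath P) (q : P) (h : PLe q a.dom) :
    (a.leftRestrict q h).toList = lrun q a.toList := by
  have ha : a.dom :: a.toList.tail = a.toList := List.cons_head_tail a.ne_nil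
  change a.toList.tail.scanl ProjOps.ast q = _
  rw [scanl_eq_lrun]
  conv_rhs => rw [← ha, lrun]
  simp only [h.ast_right]

theorem rightRestrict_self (a : PPath P) (h : PLe a.cod a.cod) : a.rightRestrict a.cod h = a := by
  ext1
  rw [rightRestrict_toList]
  exact rrun_self a.ne_nil a.chain

/-- Right restriction to the end of a left restriction is that left restriction. -/
theorem rrun_foldl {x p : P} {l : List P} (hc : (p :: l).IsChain FRel) (hx : PLe x p) :
    rrun (p :: l) (l.foldl ProjOps.ast x) = x :: lrun x l := by
  induction l generalizing x p with
  | nil => simp [rrun, lrun, hx.times_left]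
  | cons q l ih =>
    rw [List.isChain_cons_cons] at hc
    have h1 := ih hc.2 (ast_ple x q)
    rw [List.foldl_cons, rrun, lrun, h1]
    have h2 := congrArg List.head? h1
    simp only [rrun, List.head?_cons, Option.some.injEq] at h2
    rw [List.foldr_cons, h2, sp1_le (by rwa [hc.1.1])]

theorem rrun_foldl' {x : P} {a : PPath P} (hx : PLe x a.dom) :
    rrun a.toList (a.toList.foldl ProjOps.ast x) = lrun x a.toList := by
  have ha : a.dom :: a.toList.tail = a.toList := List.cons_head_tail a.ne_nil
  have hc := a.chain
  rw [← ha] at hc ⊢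
  rw [List.foldl_cons, lrun, hx.ast_right]
  exact rrun_foldl hc hx

theorem lrun_foldr (y : P) {l : List P} (hc : l.IsChain FRel) :
    lrun (l.foldr ProjOps.times y) l = rrun l y := by
  induction l with
  | nil => rfl
  | cons p l ih =>
    cases l with
    | nil => simp [rrun, lrun, ProjectionAlgebra.p4]
    | cons q l =>
      rw [List.isChain_cons_cons] at hc
      have h1 := ih hc.2
      have hD : PLe ((q :: l).foldr ProjOps.times y) q := times_ple _ _
      set D := (q :: l).foldr ProjOps.times y with hDd
      have h2 : (p ⊠ D) ⊛ q = D := sp2_le (by rwa [hc.1.2])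
      rw [rrun, ← h1, List.foldr_cons, ← hDd, lrun, ProjectionAlgebra.p4]
      rw [lrun, lrun, h2, hD.ast_right]

theorem foldl_ple (x : P) (a : PPath P) : PLe (a.toList.foldl ProjOps.ast x) a.cod := by
  have ha : a.toList.dropLast ++ [a.cod] = a.toList := List.dropLast_append_getLast a.ne_nil
  rw [← ha, List.foldl_append]
  exact ast_ple _ _

theorem foldr_ple (x : P) (a : PPath P) : PLe (a.toList.foldr ProjOps.times x) a.dom := by
  have ha : a.dom :: a.toList.tail = a.toList := List.cons_head_tail a.ne_nil
  rw [← ha]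
  exact times_ple _ _

/-- The chain semigroup. -/
instance : DRCRestrictionSemigroup (Chain P) where
  mul := mul
  mul_assoc x y z := by
    induction x using ind with | _ a
    induction y using ind with | _ b
    induction z using ind with | _ c
    exact Quotient.sound (bullet_assoc a b c)
  dplus := plus
  dstar := star
  plus_mul x := by
    induction x using ind with | _ a
    change mul _ _ = _
    have h : PLe a.dom a.dom := (ProjectionAlgebra.l1 _).symm
    rw [plus_mk, single_mul_mk h, leftRestrict_self]
  mul_star x := by
    induction x using ind with | _ a
    change mul _ _ = _
    have h : PLe a.cod a.cod := (ProjectionAlgebra.l1 _).symm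
    rw [star_mk, mk_mul_single h, rightRestrict_self]
  plus_congr x y := by
    induction x using ind with | _ a
    induction y using ind with | _ b
    change plus (mk _) = plus (mk (a.bullet (PPath.single b.dom)))
    rw [plus_mk, plus_mk, PPath.bullet_dom, PPath.bullet_dom]
    rfl
  star_congr x y := by
    induction x using ind with | _ a
    induction y using ind with | _ b
    change star (mk _) = star (mk ((PPath.single a.cod).bullet b))
    rw [star_mk, star_mk, PPath.bullet_cod, PPath.bullet_cod]
    rfl
  plus_sandwich x y := by
    induction x using ind with | _ a
    induction y using ind with | _ b
    change single (a.bullet b).dom = mul (mul (single a.dom) (single (a.bullet b).dom)) (single a.dom)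
    have h : PLe (a.bullet b).dom a.dom := by
      rw [PPath.bullet_dom]
      exact foldr_ple _ _
    set t := (a.bullet b).dom
    have h1 : mul (single a.dom) (single t) = single t :=
      mk_mul_single (a := PPath.single a.dom) h
    have h2 : mul (single t) (single a.dom) = single t :=
      single_mul_mk (a := PPath.single a.dom) h
    rw [h1, h2]
  star_sandwich x y := by
    induction x using ind with | _ a
    induction y using ind with | _ b
    change single (a.bullet b).cod = mul (mul (single b.cod) (single (a.bullet b).cod)) (single b.cod)
    have h : PLe (a.bullet b).cod b.cod := by
      rw [PPath.bullet_cod]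
      exact foldl_ple _ _
    set t := (a.bullet b).cod
    have h1 : mul (single b.cod) (single t) = single t :=
      mk_mul_single (a := PPath.single b.cod) h
    have h2 : mul (single t) (single b.cod) = single t :=
      single_mul_mk (a := PPath.single b.cod) h
    rw [h1, h2]
  plus_plus x := by induction x using ind with | _ a; rfl
  star_star x := by induction x using ind with | _ a; rfl
  star_plus x := by induction x using ind with | _ a; rfl
  plus_star x := by induction x using ind with | _ a; rfl
  ample_right x y := by
    induction x using ind with | _ a
    induction y using ind with | _ b
    change mul (mk a) (single (b.bullet a).cod) =
      mul (single (b.bullet (PPath.single a.dom)).cod) (mk a)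
    rw [show (b.bullet (PPath.single a.dom)).cod = b.cod ⊛ a.dom from PPath.bullet_cod _ _,
      PPath.bullet_cod, mk_mul_single (foldl_ple _ _), single_mul_mk (ast_ple _ _)]
    congr 1
    ext1
    rw [rightRestrict_toList, leftRestrict_toList, ← rrun_foldl' (ast_ple _ _)]
    congr 1
    rw [← List.cons_head_tail a.ne_nil]
    change a.toList.tail.foldl ProjOps.ast (b.cod ⊛ a.dom) =
      a.toList.tail.foldl ProjOps.ast ((b.cod ⊛ a.dom) ⊛ a.dom)
    rw [ast_idem]
  ample_left x y := by
    induction x using ind with | _ a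
    induction y using ind with | _ b
    change mul (single (a.bullet b).dom) (mk a) =
      mul (mk a) (single ((PPath.single a.cod).bullet b).dom)
    rw [show ((PPath.single a.cod).bullet b).dom = a.cod ⊠ b.dom from PPath.bullet_dom _ _,
      PPath.bullet_dom, mk_mul_single (times_ple _ _), single_mul_mk (foldr_ple _ _)]
    congr 1
    ext1
    rw [rightRestrict_toList, leftRestrict_toList, ← lrun_foldr _ a.chain]
    congr 1
    rw [← List.dropLast_append_getLast a.ne_nil, List.foldr_append, List.foldr_append]
    exact congrArg (List.foldr ProjOps.times · _) (times_idem _ _).symm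

end Chain

/-! Homomorphisms -/

/-- Homomorphisms of projection algebras. -/
@[ext]
structure ProjHom (P Q : Type u) [ProjOps P] [ProjOps Q] where
  toFun : P → Q
  map_times : ∀ x y, toFun (x ⊠ y) = toFun x ⊠ toFun y
  map_ast : ∀ x y, toFun (x ⊛ y) = toFun x ⊛ toFun y

/-- `(2,1,1)`-homomorphisms of DRC semigroups. -/
@[ext]
structure DRCHom (S T : Type u) [DRCSemigroup S] [DRCSemigroup T] where
  toFun : S → T
  map_mul : ∀ x y, toFun (x * y) = toFun x * toFun y
  map_plus : ∀ x, toFun (DRCSemigroup.dplus x) = DRCSemigroup.dplus (toFun x)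
  map_star : ∀ x, toFun (DRCSemigroup.dstar x) = DRCSemigroup.dstar (toFun x)

/-- The restriction of a `(2,1,1)`-homomorphism to projections. -/
def DRCHom.onProj {S T : Type u} [DRCSemigroup S] [DRCSemigroup T] (φ : DRCHom S T) :
    ProjHom (Proj S) (Proj T) where
  toFun e := ⟨φ.toFun e.1, φ.toFun e.1, by rw [← φ.map_plus, e.plus_val]⟩
  map_times x y := by
    ext
    change φ.toFun (DRCSemigroup.dplus (x.1 * y.1)) = DRCSemigroup.dplus (_ * _)
    rw [φ.map_plus, φ.map_mul]
  map_ast x y := by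
    ext
    change φ.toFun (DRCSemigroup.dstar (x.1 * y.1)) = DRCSemigroup.dstar (_ * _)
    rw [φ.map_star, φ.map_mul]

section Map

variable {P Q : Type u}

theorem ProjHom.fRel [ProjOps P] [ProjOps Q] (ψ : ProjHom P Q) {p q : P} (h : FRel p q) :
    FRel (ψ.toFun p) (ψ.toFun q) :=
  ⟨by rw [← ψ.map_times, h.1], by rw [← ψ.map_ast, h.2]⟩

/-- The map `(p₁, …, pₖ) ↦ (p₁ψ, …, pₖψ)` on paths. -/
def PPath.map [ProjOps P] [ProjOps Q] (ψ : ProjHom P Q) (a : PPath P) : PPath Q where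
  toList := a.toList.map ψ.toFun
  ne_nil := by simpa using a.ne_nil
  chain := (List.isChain_map _).2 (a.chain.imp fun _ _ h => ψ.fRel h)

theorem PPath.map_dom [ProjOps P] [ProjOps Q] (ψ : ProjHom P Q) (a : PPath P) :
    (a.map ψ).dom = ψ.toFun a.dom := by
  simp [PPath.map, PPath.dom]

theorem PPath.map_cod [ProjOps P] [ProjOps Q] (ψ : ProjHom P Q) (a : PPath P) :
    (a.map ψ).cod = ψ.toFun a.cod := by
  simp [PPath.map, PPath.cod]

theorem map_foldr [ProjOps P] [ProjOps Q] (ψ : ProjHom P Q) (x : P) (l : List P) :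
    ψ.toFun (l.foldr ProjOps.times x) = (l.map ψ.toFun).foldr ProjOps.times (ψ.toFun x) := by
  induction l with
  | nil => rfl
  | cons p l ih => simp [ψ.map_times, ih]

theorem map_rrun [ProjOps P] [ProjOps Q] (ψ : ProjHom P Q) (x : P) (l : List P) :
    (rrun l x).map ψ.toFun = rrun (l.map ψ.toFun) (ψ.toFun x) := by
  induction l with
  | nil => rfl
  | cons p l ih => simp [rrun, ψ.map_times, ih, map_foldr]

theorem map_lrun [ProjOps P] [ProjOps Q] (ψ : ProjHom P Q) (x : P) (l : List P) :
    (lrun x l).map ψ.toFun = lrun (ψ.toFun x) (l.map ψ.toFun) := by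
  induction l generalizing x with
  | nil => rfl
  | cons p l ih => simp [lrun, ψ.map_ast, ih]

theorem LEqv.list_map [ProjOps P] [ProjOps Q] (ψ : ProjHom P Q) {l m : List P} (h : LEqv l m) :
    LEqv (l.map ψ.toFun) (m.map ψ.toFun) := by
  induction h with
  | rel _ _ h =>
    obtain ⟨l, m, hg⟩ := h
    simp only [List.map_append]
    refine .rel _ _ (.mk _ _ ?_)
    cases hg with
    | idem p => exact .idem _
    | adm e p f h =>
      simp only [List.map_cons, List.map_nil, ψ.map_ast, ψ.map_times]
      refine .adm _ _ _ ⟨?_, ?_⟩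
      · rw [← ψ.map_ast, ← ψ.map_ast, ← h.1]
      · rw [← ψ.map_times, ← ψ.map_times, ← h.2]
  | refl _ => exact .refl _
  | symm _ _ _ ih => exact .symm _ _ ih
  | trans _ _ _ _ _ ih1 ih2 => exact .trans _ _ _ ih1 ih2

variable [StrongProjectionAlgebra P] [StrongProjectionAlgebra Q]

theorem PPath.map_congr (ψ : ProjHom P Q) {a b : PPath P} (h : PathCongr a b) :
    PathCongr (a.map ψ) (b.map ψ) :=
  LEqv.congr (h.leqv.list_map ψ)

/-- The `(2,1,1)`-homomorphism `[p₁, …, pₖ] ↦ [p₁ψ, …, pₖψ]` of chain semigroups. -/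
def Chain.map (ψ : ProjHom P Q) : DRCHom (Chain P) (Chain Q) where
  toFun := Quotient.map (PPath.map ψ) (fun _ _ h => PPath.map_congr ψ h)
  map_mul x y := by
    induction x using Chain.ind with | _ a
    induction y using Chain.ind with | _ b
    change Chain.mk ((a.bullet b).map ψ) = Chain.mk ((a.map ψ).bullet (b.map ψ))
    congr 1
    ext1
    rw [PPath.bullet_toList, PPath.map_dom, PPath.map_cod]
    change (a.bullet b).toList.map _ = rrun (a.toList.map _) _ ++ lrun _ (b.toList.map _)
    rw [PPath.bullet_toList, List.map_append, map_rrun, map_lrun]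
  map_plus x := by
    induction x using Chain.ind with | _ a
    change Chain.mk ((PPath.single a.dom).map ψ) = Chain.mk (PPath.single (a.map ψ).dom)
    rw [PPath.map_dom]
    rfl
  map_star x := by
    induction x using Chain.ind with | _ a
    change Chain.mk ((PPath.single a.cod).map ψ) = Chain.mk (PPath.single (a.map ψ).cod)
    rw [PPath.map_cod]
    rfl

theorem Chain.map_mk (ψ : ProjHom P Q) (a : PPath P) :
    (Chain.map ψ).toFun (Chain.mk a) = Chain.mk (a.map ψ) := rfl

end Map

/-! The categories and functors -/

/-- Strong projection algebras (on nonempty sets). -/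
structure SPA : Type (u + 1) where
  carrier : Type u
  [alg : StrongProjectionAlgebra carrier]
  [nonempty : Nonempty carrier]

attribute [instance] SPA.alg SPA.nonempty

/-- The category of strong projection algebras and projection algebra homomorphisms. -/
instance : Category SPA.{u} where
  Hom P Q := ProjHom P.carrier Q.carrier
  id P := ⟨id, fun _ _ => rfl, fun _ _ => rfl⟩
  comp f g := ⟨g.toFun ∘ f.toFun,
    fun x y => by simp [f.map_times, g.map_times], fun x y => by simp [f.map_ast, g.map_ast]⟩

/-- DRC-restriction semigroups (on nonempty sets). -/
structure DRS : Type (u + 1) where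
  carrier : Type u
  [alg : DRCRestrictionSemigroup carrier]
  [nonempty : Nonempty carrier]

attribute [instance] DRS.alg DRS.nonempty

/-- The category of DRC-restriction semigroups and `(2,1,1)`-homomorphisms. -/
instance : Category DRS.{u} where
  Hom S T := DRCHom S.carrier T.carrier
  id S := ⟨id, fun _ _ => rfl, fun _ => rfl, fun _ => rfl⟩
  comp f g := ⟨g.toFun ∘ f.toFun,
    fun x y => by simp [f.map_mul, g.map_mul], fun x => by simp [f.map_plus, g.map_plus],
    fun x => by simp [f.map_star, g.map_star]⟩

instance (S : Type u) [DRCSemigroup S] [h : Nonempty S] : Nonempty (Proj S) :=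
  h.elim fun x => ⟨⟨DRCSemigroup.dplus x, x, rfl⟩⟩

instance (P : Type u) [ProjOps P] [h : Nonempty P] : Nonempty (Chain P) :=
  h.elim fun p => ⟨Chain.single p⟩

/-- The forgetful functor `S ↦ P(S)`, `φ ↦ φ|_{P(S)}`. -/
def U : DRS.{u} ⥤ SPA.{u} where
  obj S := ⟨Proj S.carrier⟩
  map φ := DRCHom.onProj φ

/-- The functor that sends `P` to its chain semigroup, and `ψ` to
`[p₁, …, pₖ] ↦ [p₁ψ, …, pₖψ]`. -/
def V : SPA.{u} ⥤ DRS.{u} where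
  obj P := ⟨Chain P.carrier⟩
  map ψ := Chain.map ψ
  map_id P := by
    apply DRCHom.ext
    funext x
    induction x using Chain.ind with | _ a
    change Chain.mk _ = Chain.mk a
    congr 1
    ext1
    exact List.map_id _
  map_comp f g := by
    apply DRCHom.ext
    funext x
    induction x using Chain.ind with | _ a
    change Chain.mk _ = Chain.mk _
    congr 1
    ext1
    exact (List.map_map (f := f.toFun) (g := g.toFun) (l := a.toList)).symm

/-- `S` is free over the strong projection algebra `P` with respect to `φ : P ⟶ P(S)`: every
homomorphism from `P` to the projection algebra of a DRC-restriction semigroup `T` extends uniquely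
along `φ` to a `(2,1,1)`-homomorphism from `S` to `T`. -/
def IsFreeOver {P : SPA.{u}} {S : DRS.{u}} (φ : P ⟶ U.obj S) : Prop :=
  ∀ (T : DRS.{u}) (ψ : P ⟶ U.obj T), ∃! Ψ : S ⟶ T, φ ≫ U.map Ψ = ψ

end ChainSG

/-! The chain semigroup is generated by the chains `[p]`, and the relations it satisfies are ones
that projections satisfy in every DRC-restriction semigroup.

Uniqueness. If `p F q` then `p ⊠ q = p` and `p ⊛ q = q`, so multiplying `[q, …]` on the left by
`[p]` restricts nothing and merely prepends `p` (`Chain.single_mul_mk_cons`). Hence `[p₁, …, pₖ] =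
[p₁] • ⋯ • [pₖ]`, and a homomorphism is determined by the images of the `[p]`.

Existence. This forces `[p₁, …, pₖ]Φ = (p₁φ)⋯(pₖφ)`, and three things need checking. For projections
of `S` one has `ee = e`, `e(e ⊛ p) = ep` and `(p ⊠ f)f = pf`, so both kinds of generating pair have
equal products, and the product depends only on the chain (`LEqv.projProd_eq`). The same identities,
together with `(e ⊠ f)(e ⊛ f) = ef`, show that the restrictions made in forming `𝔭 • 𝔮` do not
change the product in `S`, so the map is multiplicative (`projProd_rrun_mul_lrun`). Finally, along a
path the congruence law gives `(p₁p₂⋯pₖ)⁺ = (p₁p₂)⁺ = p₁ ⊠ p₂ = p₁` by induction, and dually for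
`*`, so the unary operations are preserved (`dplus_prod`, `dstar_prod`).

The products are computed in `S¹`, where the empty list is allowed and concatenation becomes
multiplication; injectivity of `S → S¹` brings the equations back to `S`.

The map `p ↦ [p]` is thus a universal arrow from `P` to the forgetful functor. The adjunction and
the description of all free objects follow formally, since universal arrows from the same object
differ by a unique isomorphism and remain universal after composition with one. -/

namespace ChainSG

open DRCSemigroup

/-! ### Products of projections in a DRC semigroup -/

section ProjProd

variable {S : Type u}

/-- The product in `S¹` of a list of projections of `S`. -/
def projProd [DRCSemigroup S] (l : List (Proj S)) : WithOne S :=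
  (l.map fun e => (e.1 : WithOne S)).prod

section DRC
variable [DRCSemigroup S]

@[simp]
theorem projProd_nil : projProd ([] : List (Proj S)) = 1 := rfl

@[simp]
theorem projProd_cons (e : Proj S) (l : List (Proj S)) :
    projProd (e :: l) = (e.1 : WithOne S) * projProd l := by
  simp [projProd]

@[simp]
theorem projProd_append (l m : List (Proj S)) :
    projProd (l ++ m) = projProd l * projProd m := by
  simp [projProd]

theorem Proj.coe_mul_self_mul (e : Proj S) (x : WithOne S) :
    (e.1 : WithOne S) * (e.1 * x) = e.1 * x := by
  rw [← mul_assoc, ← WithOne.coe_mul, e.mul_self]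

theorem Proj.coe_times_mul (e f : Proj S) :
    ((e ⊠ f).1 : WithOne S) * f.1 = e.1 * f.1 := by
  rw [← WithOne.coe_mul, Proj.times_mul, WithOne.coe_mul]

theorem Proj.coe_mul_ast (e f : Proj S) :
    (e.1 : WithOne S) * (e ⊛ f).1 = e.1 * f.1 := by
  rw [← WithOne.coe_mul, Proj.mul_ast, WithOne.coe_mul]

theorem Proj.coe_times_mul_ast (e f : Proj S) :
    ((e ⊠ f).1 : WithOne S) * (e ⊛ f).1 = e.1 * f.1 := by
  have h : (f.1 : WithOne S) * (e ⊛ f).1 = (e ⊛ f).1 := by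
    rw [← WithOne.coe_mul, Proj.mul_ast_right]
  -- An `f` is inserted in the middle: `(e ⊠ f)(e ⊛ f) = (e ⊠ f)f(e ⊛ f) = ef(e ⊛ f) = e(e ⊛ f) =
  -- ef`.
  rw [← h, ← mul_assoc, Proj.coe_times_mul, mul_assoc, h, Proj.coe_mul_ast]

/-- The left factor is already the first factor of the product (it is `x` itself when `l` is empty),
and projections are idempotent. -/
theorem foldr_mul_projProd_rrun (l : List (Proj S)) (x : Proj S) :
    ((l.foldr ProjOps.times x).1 : WithOne S) * (projProd (rrun l x) * x.1) =
      projProd (rrun l x) * x.1 := by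
  cases l with
  | nil => simpa [rrun] using x.coe_mul_self_mul 1
  | cons e l =>
    simp only [rrun, projProd_cons, List.foldr_cons, mul_assoc]
    exact Proj.coe_mul_self_mul _ _

/-- Right restriction is invisible to the product. If `D` is the first factor of the restricted tail
followed by `x`, the new leading factor is `e ⊠ D`. A spare copy of `D` can be split off by
idempotency, and `(e ⊠ D)D = eD` turns the leading factor into `e`. -/
theorem projProd_rrun_mul (l : List (Proj S)) (x : Proj S) :
    projProd (rrun l x) * x.1 = projProd l * x.1 := by
  induction l with
  | nil => rfl
  | cons e l ih =>
    rw [rrun, projProd_cons, projProd_cons, mul_assoc, mul_assoc, ← ih,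
      ← foldr_mul_projProd_rrun l x, ← mul_assoc, Proj.coe_times_mul, mul_assoc]

/-- Left restriction is invisible as well: `x(x ⊛ e) = xe` undoes one restriction at a time, with `x
⊛ e` as the starting point for the rest of the list. -/
theorem mul_projProd_lrun (x : Proj S) (l : List (Proj S)) :
    (x.1 : WithOne S) * projProd (lrun x l) = x.1 * projProd l := by
  induction l generalizing x with
  | nil => rfl
  | cons e l ih =>
    rw [lrun, projProd_cons, projProd_cons, ih, ← mul_assoc, ← mul_assoc, Proj.coe_mul_ast]

/-- The left-hand list is the one underlying the product of paths ending in `e` and beginning with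
`f`, so this is multiplicativity of the evaluation map. The two restrictions cancel up to the
junction, where the factors `e ⊠ f` and `e ⊛ f` multiply to `ef`. -/
theorem projProd_rrun_mul_lrun (l m : List (Proj S)) (e f : Proj S) :
    projProd (rrun (l ++ [e]) f ++ lrun e (f :: m)) = projProd ((l ++ [e]) ++ (f :: m)) := by
  simp only [rrun_append, rrun, lrun, projProd_append, projProd_cons, projProd_nil,
    List.foldr_cons, List.foldr_nil, mul_one]
  rw [projProd_rrun_mul, mul_projProd_lrun]
  simp only [mul_assoc]
  rw [← mul_assoc ((e ⊠ f).1 : WithOne S), Proj.coe_times_mul_ast, mul_assoc]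

theorem LEqv.projProd_eq {l m : List (Proj S)} (h : LEqv l m) : projProd l = projProd m := by
  induction h with
  | rel _ _ h =>
    obtain ⟨l, m, hg⟩ := h
    simp only [projProd_append]
    congr 2
    cases hg with
    | idem p => simpa using p.coe_mul_self_mul 1
    | adm e p f _ =>
      simp only [projProd_cons, projProd_nil, mul_one]
      rw [Proj.coe_times_mul, ← mul_assoc, Proj.coe_mul_ast, mul_assoc]
  | refl _ => rfl
  | symm _ _ _ ih => exact ih.symm
  | trans _ _ _ _ _ ih1 ih2 => exact ih1.trans ih2

/-- The product in `S` of the entries of a path of projections of `S`. -/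
def PPath.prod (a : PPath (Proj S)) : S :=
  a.toList.tail.foldl (fun s e => s * e.1) a.dom.1

/-- A path is nonempty, so its product already lies in `S`; this links it to the product in `S¹`,
where the list identities live. -/
theorem PPath.coe_prod (a : PPath (Proj S)) : (a.prod : WithOne S) = projProd a.toList := by
  have key : ∀ (l : List (Proj S)) (s : S),
      ((l.foldl (fun s e => s * e.1) s : S) : WithOne S) = s * projProd l := by
    intro l
    induction l with
    | nil => simp
    | cons e l ih => intro s; simp [ih, mul_assoc]
  rw [PPath.prod, key, ← projProd_cons]
  exact congrArg projProd (List.cons_head_tail a.ne_nil)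

/-- Evaluation along `φ` descends to chains: a homomorphism carries generating pairs over `P` to
generating pairs over the projections of `S`, and those have equal products. -/
theorem PathCongr.prod_eq {P : Type u} [StrongProjectionAlgebra P] (φ : ProjHom P (Proj S))
    {a b : PPath P} (h : PathCongr a b) : (a.map φ).prod = (b.map φ).prod := by
  rw [← WithOne.coe_inj, PPath.coe_prod, PPath.coe_prod]
  exact (h.leqv.list_map φ).projProd_eq

/-- With `b` the product of the remaining path `(f, …)`, induction gives `b⁺ = f`, so `(eb)⁺ =
(eb⁺)⁺ = e ⊠ f = e`, the last step because `e F f`. -/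
theorem dplus_prod {e : Proj S} {l : List (Proj S)} (h : (e :: l).IsChain FRel) {s : S}
    (hs : (s : WithOne S) = projProd (e :: l)) : dplus s = e.1 := by
  induction l generalizing e s with
  | nil =>
    obtain rfl : s = e.1 := by simpa using hs
    exact e.plus_val
  | cons f l ih =>
    rw [List.isChain_cons_cons] at h
    let b : PPath (Proj S) := ⟨f :: l, by simp, h.2⟩
    have hs' : s = e.1 * b.prod := by
      rw [← WithOne.coe_inj, WithOne.coe_mul, b.coe_prod, hs, projProd_cons]
    rw [hs', plus_congr, ih h.2 b.coe_prod, ← Proj.times_val, h.1.1]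

/-- The dual argument peels entries off the right end: `(be)* = (b*e)* = f ⊛ e = e` when `f F e` are
the last two entries. -/
theorem dstar_prod {e : Proj S} {l : List (Proj S)} (h : (l ++ [e]).IsChain FRel) {s : S}
    (hs : (s : WithOne S) = projProd (l ++ [e])) : dstar s = e.1 := by
  induction l using List.reverseRecOn generalizing e s with
  | nil =>
    obtain rfl : s = e.1 := by simpa using hs
    exact e.star_val
  | append_singleton l f ih =>
    have hl : (l ++ [f]).IsChain FRel := h.prefix (List.prefix_append _ _)
    have hfe : FRel f e := by
      rw [List.isChain_append] at h
      exact h.2.2 f (by simp) e (by simp)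
    let b : PPath (Proj S) := ⟨l ++ [f], by simp, hl⟩
    have hs' : s = b.prod * e.1 := by
      rw [← WithOne.coe_inj, WithOne.coe_mul, b.coe_prod, hs, projProd_append _ [e]]
      simp [b]
    rw [hs', star_congr, ih hl b.coe_prod, ← Proj.ast_val, hfe.2]

theorem PPath.dplus_prod (a : PPath (Proj S)) : dplus a.prod = a.dom.1 := by
  have ha : a.dom :: a.toList.tail = a.toList := List.cons_head_tail a.ne_nil
  exact ChainSG.dplus_prod (by rw [ha]; exact a.chain) (by rw [ha]; exact a.coe_prod)

theorem PPath.dstar_prod (a : PPath (Proj S)) : dstar a.prod = a.cod.1 := by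
  have ha : a.toList.dropLast ++ [a.cod] = a.toList := List.dropLast_append_getLast a.ne_nil
  exact ChainSG.dstar_prod (by rw [ha]; exact a.chain) (by rw [ha]; exact a.coe_prod)

end DRC

end ProjProd

/-! ### Existence and uniqueness of extensions to the chain semigroup -/

namespace Chain

section Lift

variable {P S : Type u} [StrongProjectionAlgebra P]

/-- The `(2,1,1)`-homomorphism `[p₁, …, pₖ] ↦ (p₁φ)⋯(pₖφ)` that extends a homomorphism `φ` from `P`
to the projection algebra of `S`. -/
def lift [DRCSemigroup S] (φ : ProjHom P (Proj S)) : DRCHom (Chain P) S where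
  toFun := Quotient.lift (fun a => (a.map φ).prod) (fun _ _ h => PathCongr.prod_eq φ h)
  map_mul x y := by
    induction x using Chain.ind with | _ a
    induction y using Chain.ind with | _ b
    change ((a.bullet b).map φ).prod = (a.map φ).prod * (b.map φ).prod
    have ha : a.toList.dropLast ++ [a.cod] = a.toList := List.dropLast_append_getLast a.ne_nil
    have hb : b.dom :: b.toList.tail = b.toList := List.cons_head_tail b.ne_nil
    rw [← WithOne.coe_inj, WithOne.coe_mul, PPath.coe_prod, PPath.coe_prod, PPath.coe_prod]
    change projProd ((a.bullet b).toList.map φ.toFun) =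
      projProd (a.toList.map φ.toFun) * projProd (b.toList.map φ.toFun)
    -- Exposing the last entry of `a` and the first entry of `b` gives the two lists the shape `l ++
    -- [e]` and `f :: m` of the junction identity.
    rw [PPath.bullet_toList, List.map_append, map_rrun, map_lrun, ← projProd_append, ← ha, ← hb,
      List.map_append, List.map_cons, List.map_cons, List.map_nil, projProd_rrun_mul_lrun]
  map_plus x := by
    induction x using Chain.ind with | _ a
    change (φ.toFun a.dom).1 = dplus (a.map φ).prod
    rw [PPath.dplus_prod, PPath.map_dom]
  map_star x := by
    induction x using Chain.ind with | _ a
    change (φ.toFun a.cod).1 = dstar (a.map φ).prod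
    rw [PPath.dstar_prod, PPath.map_cod]

theorem lrun_self {p : P} {l : List P} (h : (p :: l).IsChain FRel) : lrun p l = l := by
  induction l generalizing p with
  | nil => rfl
  | cons q l ih =>
    rw [List.isChain_cons_cons] at h
    rw [lrun, h.1.2, ih h.2]

/-- Since `p ⊠ q = p` and `p ⊛ q = q`, both restrictions are trivial and the two paths agree on the
nose. Iterating shows that the chains `[p]` generate the semigroup. -/
theorem single_mul_mk_cons {p q : P} {l : List P} (h : (p :: q :: l).IsChain FRel) :
    single p * mk ⟨q :: l, by simp, h.tail⟩ = mk ⟨p :: q :: l, by simp, h⟩ := by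
  change mk ((PPath.single p).bullet _) = _
  congr 1
  ext1
  rw [PPath.bullet_toList]
  change (p ⊠ q) :: lrun p (q :: l) = _
  rw [(List.isChain_cons_cons.1 h).1.1, lrun_self h]

/-- A homomorphism from a chain semigroup is determined by its values on the chains `[p]`. -/
theorem hom_ext [DRCSemigroup S] {Φ Ψ : DRCHom (Chain P) S}
    (h : ∀ p, Φ.toFun (single p) = Ψ.toFun (single p)) : Φ = Ψ := by
  apply DRCHom.ext
  funext x
  induction x using Chain.ind with | _ a
  obtain ⟨l, hl, hc⟩ := a
  cases l with
  | nil => exact absurd rfl hl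
  | cons p l =>
    induction l generalizing p with
    | nil => exact h p
    | cons q l ih =>
      rw [← single_mul_mk_cons hc, Φ.map_mul, Ψ.map_mul, h, ih q (by simp) hc.tail]

theorem dplus_single (p : P) : dplus (single p) = single p := rfl

/-- The product of `[p]` and `[q]` is `[p ⊠ q, p ⊛ q]`; this equation and the next read off its two
ends. -/
theorem single_times (p q : P) : single (p ⊠ q) = dplus (single p * single q) := rfl

theorem single_ast (p q : P) : single (p ⊛ q) = dstar (single p * single q) := rfl

/-- The projections of the chain semigroup are the chains `[p]`. -/
theorem exists_dplus_eq_iff (x : Chain P) : (∃ y, dplus y = x) ↔ ∃ p, x = single p := by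
  constructor
  · rintro ⟨y, rfl⟩
    induction y using Chain.ind with | _ a
    exact ⟨a.dom, rfl⟩
  · rintro ⟨p, rfl⟩
    exact ⟨_, dplus_single p⟩

/-- The homomorphism `p ↦ [p]` from `P` to the projection algebra of its chain semigroup. -/
def singleHom (P : Type u) [StrongProjectionAlgebra P] : ProjHom P (Proj (Chain P)) where
  toFun p := ⟨single p, single p, dplus_single p⟩
  map_times p q := Proj.ext (single_times p q)
  map_ast p q := Proj.ext (single_ast p q)

end Lift

end Chain

/-! ### The adjunction and the free objects -/

/-- The map `p ↦ [p]` as a morphism of strong projection algebras. -/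
def chainUnit (P : SPA.{u}) : P ⟶ U.obj (V.obj P) := Chain.singleHom P.carrier

/-- The extension evaluates the one-entry path `(p)` as a one-factor product, so it returns `pφ` by
computation. -/
theorem chainUnit_comp_lift {P : SPA.{u}} {S : DRS.{u}} (φ : P ⟶ U.obj S) :
    chainUnit P ≫ U.map (show V.obj P ⟶ S from Chain.lift φ) = φ := rfl

theorem chain_hom_ext {P : SPA.{u}} {S : DRS.{u}} {Φ Ψ : V.obj P ⟶ S}
    (h : chainUnit P ≫ U.map Φ = chainUnit P ≫ U.map Ψ) : Φ = Ψ :=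
  Chain.hom_ext fun p => congrArg Subtype.val (congrFun (congrArg ProjHom.toFun h) p)

/-- The functor `V` is left adjoint to `U`. -/
def chainAdjunction : V.{u} ⊣ U.{u} :=
  Adjunction.mkOfHomEquiv
    { homEquiv := fun P _ =>
        { toFun := fun Φ => chainUnit P ≫ U.map Φ
          invFun := fun φ => Chain.lift φ
          left_inv := fun _ => chain_hom_ext (chainUnit_comp_lift _)
          right_inv := fun φ => chainUnit_comp_lift φ }
      -- Two homomorphisms out of a chain semigroup need comparing only on the chains `[p]`, where
      -- both sides compute to the same value.
      homEquiv_naturality_left_symm := fun _ _ => chain_hom_ext rfl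
      homEquiv_naturality_right := fun _ _ => rfl }

theorem isFreeOver_chainUnit (P : SPA.{u}) : IsFreeOver (chainUnit P) := fun _ ψ =>
  ⟨Chain.lift ψ, chainUnit_comp_lift ψ, fun _ h => chain_hom_ext h⟩

/-- Both morphisms solve the extension problem posed by `φ ≫ U.map Ψ`. -/
theorem IsFreeOver.hom_ext {P : SPA.{u}} {S T : DRS.{u}} {φ : P ⟶ U.obj S} (h : IsFreeOver φ)
    {Φ Ψ : S ⟶ T} (e : φ ≫ U.map Φ = φ ≫ U.map Ψ) : Φ = Ψ :=
  (h T _).unique e rfl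

theorem IsFreeOver.comp_iso {P : SPA.{u}} {S T : DRS.{u}} {φ : P ⟶ U.obj S} (h : IsFreeOver φ)
    (θ : S ≅ T) : IsFreeOver (φ ≫ U.map θ.hom) := by
  intro R ψ
  obtain ⟨Ψ, hΨ, -⟩ := h R ψ
  refine ⟨θ.inv ≫ Ψ, ?_, fun Ψ' h' => ?_⟩
  · simp only [Category.assoc, ← U.map_comp, Iso.hom_inv_id_assoc, hΨ]
  · rw [Iso.eq_inv_comp]
    refine h.hom_ext ?_
    rw [hΨ, U.map_comp, ← Category.assoc, h']

/-- Each universal arrow factors through the other; both composites of the factorizations fix a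
universal arrow, hence are identities. An isomorphism is determined by its forward morphism, which
freeness of `φ` makes unique. -/
theorem IsFreeOver.existsUnique_iso {P : SPA.{u}} {S T : DRS.{u}} {φ : P ⟶ U.obj S}
    {ψ : P ⟶ U.obj T} (hφ : IsFreeOver φ) (hψ : IsFreeOver ψ) :
    ∃! θ : S ≅ T, φ ≫ U.map θ.hom = ψ := by
  obtain ⟨Φ, hΦ, -⟩ := hφ T ψ
  obtain ⟨Ψ, hΨ, -⟩ := hψ S φ
  refine ⟨⟨Φ, Ψ, hφ.hom_ext ?_, hψ.hom_ext ?_⟩, hΦ, fun θ hθ => Iso.ext (hφ.hom_ext ?_)⟩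
  · rw [U.map_comp, ← Category.assoc, hΦ, hΨ, U.map_id, Category.comp_id]
  · rw [U.map_comp, ← Category.assoc, hΨ, hΦ, U.map_id, Category.comp_id]
  · exact hθ.trans hΦ.symm

/-- One direction compares `φ` with the universal arrow `p ↦ [p]`; the other transports universality
of that arrow along the isomorphism. -/
theorem isFreeOver_iff {P : SPA.{u}} {S : DRS.{u}} (φ : P ⟶ U.obj S) :
    IsFreeOver φ ↔ ∃! θ : V.obj P ≅ S, chainUnit P ≫ U.map θ.hom = φ := by
  constructor
  · exact (isFreeOver_chainUnit P).existsUnique_iso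
  · rintro ⟨θ, rfl, -⟩
    exact (isFreeOver_chainUnit P).comp_iso θ

end ChainSG

theorem theorem7p19 :
    ∃ adj : ChainSG.V.{u} ⊣ ChainSG.U.{u},
      -- the unit is `p ↦ [p]`, and `U (V P) = {[p] | p ∈ P}`
      (∀ (P : ChainSG.SPA.{u}) (p : P.carrier),
        ((adj.unit.app P).toFun p).val = ChainSG.Chain.single p) ∧
      (∀ (P : ChainSG.SPA.{u}) (x : ChainSG.Chain P.carrier),
        (∃ y, ChainSG.DRCSemigroup.dplus y = x) ↔ ∃ p, x = ChainSG.Chain.single p) ∧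
      -- the universal property of the unit
      (∀ (P : ChainSG.SPA.{u}) (S : ChainSG.DRS.{u}) (φ : P ⟶ ChainSG.U.obj S),
        ∃! Φ : ChainSG.V.obj P ⟶ S, adj.unit.app P ≫ ChainSG.U.map Φ = φ) ∧
      -- the free objects over `P` are the chain semigroup of `P` with the map `p ↦ [p]`, up to
      -- a unique isomorphism
      (∀ (P : ChainSG.SPA.{u}) (S : ChainSG.DRS.{u}) (φ : P ⟶ ChainSG.U.obj S),
        ChainSG.IsFreeOver φ ↔
          ∃! θ : ChainSG.V.obj P ≅ S, adj.unit.app P ≫ ChainSG.U.map θ.hom = φ) ∧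
      -- a DRC-restriction semigroup is free over some strong projection algebra if and only if it
      -- is a chain semigroup, up to isomorphism
      (∀ S : ChainSG.DRS.{u},
        (∃ (P : ChainSG.SPA.{u}) (φ : P ⟶ ChainSG.U.obj S), ChainSG.IsFreeOver φ) ↔
          ∃ P : ChainSG.SPA.{u}, Nonempty (ChainSG.V.obj P ≅ S)) := by
  -- The unit of an adjunction given by hom-set bijections is the image of the identity, here
  -- `chainUnit P ≫ U.map (𝟙 _)`, which unfolds to `chainUnit P`. The statements about `chainUnit`
  -- therefore apply to `adj.unit.app P` without rewriting.
  refine ⟨ChainSG.chainAdjunction, fun P p => rfl, fun P x => ChainSG.Chain.exists_dplus_eq_iff x, ?_, ?_, ?_⟩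
  · exact fun P S φ => ChainSG.isFreeOver_chainUnit P S φ
  · exact fun P S φ => ChainSG.isFreeOver_iff φ
  · intro S
    constructor
    · rintro ⟨P, φ, h⟩
      obtain ⟨θ, -, -⟩ := (ChainSG.isFreeOver_iff φ).1 h
      exact ⟨P, ⟨θ⟩⟩
    · rintro ⟨P, ⟨θ⟩⟩
      -- The free arrow is `p ↦ [p]` followed by the restriction of `θ` to projections.
      exact ⟨P, _, (ChainSG.isFreeOver_chainUnit P).comp_iso θ⟩
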